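/- Let $A\in\mathbb R$ be any constant, let $K\subset\mathbb R^2$ be a (non-empty) open connected set, and consider the control system of the controlled (hydrodynamical) Chaplygin sleigh (the classical sleigh being the case $A=0$) $$\dot q^1=q^4\cos q^3,\quad \dot q^2=q^4\sin q^3,\quad \dot q^3=q^5,\quad \dot q^4=w^1+A\,q^4q^5,\quad \dot q^5=w^2,$$ with states $q=(q^1,\dots,q^5)\in\mathbb R^5$ and controls $w=(w^1,w^2)\in K$. A curve on $[a,b]$ is piecewise real analytic if there is a finite subdivision of $[a,b]$ such that on each open subinterval the curve coincides with a map that is real analytic on a neighbourhood of the closed subinterval (jumps at the subdivision points are allowed). A solution on $[0,T]$ is a pair $(q(t),w(t))$ of piecewise real analytic curves, with $w(t)\in K$ for all $t$ and $q(t)$ absolutely continuous, which satisfies the equations for almost every $t\in[0,T]$. For $q_0\in\mathbb R^5$ and $T>0$ let $R_T(q_0)$ be the set of the end points $q(T)$ of all solutions on $[0,T]$ with $q(0)=q_0$, and let $R_{\le T}(q_0)=\{q_0\}\cup\bigcup_{0<T'\le T}R_{T'}(q_0)$. A state $q_0$ is a state of equilibrium if, for some $T>0$ and some control curve $w(t)$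 on $[0,T]$, the pair $(q(t)\equiv q_0,\,w(t))$ is a solution. Then the system has the hyper-accessibility property, i.e. $R_T(q_0)$ is an open subset of $\mathbb R^5$ for every $q_0\in\mathbb R^5$ and every $T>0$. Moreover, the system is small-time locally controllable, with piecewise real analytic controls, at each of its states of equilibrium $q_0$, i.e. there is $T>0$ such that $R_{\le T}(q_0)$ contains a neighbourhood of $q_0$. -/

import Mathlib

open MeasureTheory Set Topology

/-- `γ` is piecewise real analytic on `[a, b]`: there is a finite subdivision
`a = τ 0 < τ 1 < ⋯ < τ r = b` such that on each open subinterval `γ` agrees with a map which is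
real analytic on (a neighbourhood of) the closed subinterval. In particular `γ` may jump at the
subdivision points, but it has finite one-sided limits there. -/
def IsPiecewiseAnalyticOn {E : Type*} [NormedAddCommGroup E] [NormedSpace ℝ E]
    (γ : ℝ → E) (a b : ℝ) : Prop :=
  ∃ (r : ℕ) (τ : ℕ → ℝ), τ 0 = a ∧ τ r = b ∧ ∀ i < r, τ i < τ (i + 1) ∧
    ∃ g : ℝ → E, AnalyticOnNhd ℝ g (Icc (τ i) (τ (i + 1))) ∧
      EqOn γ g (Ioo (τ i) (τ (i + 1)))

/-- `(q, w)` is a piecewise real analytic solution on `[a, b]` of the control system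
`q' = f (t, q, w)` with controls in `K`: the control curve `w` is piecewise real analytic with values
in `K`, the state curve `q` is piecewise real analytic and absolutely continuous, and the equation
holds at almost every time. -/
structure IsControlSolution {n m : ℕ} (f : ℝ → (Fin n → ℝ) → (Fin m → ℝ) → (Fin n → ℝ))
    (K : Set (Fin m → ℝ)) (a b : ℝ) (q : ℝ → (Fin n → ℝ)) (w : ℝ → (Fin m → ℝ)) : Prop where
  control_mem : ∀ t ∈ Icc a b, w t ∈ K
  control_analytic : IsPiecewiseAnalyticOn w a b
  state_analytic : IsPiecewiseAnalyticOn q a b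
  state_absCont : AbsolutelyContinuousOnInterval q a b
  equation : ∀ᵐ t : ℝ, t ∈ Icc a b → HasDerivAt q (f t (q t) (w t)) t

/-- The set of states reachable from `q₀` in time exactly `T` by piecewise real analytic solutions
defined on `[0, T]`. -/
def reachExact {n m : ℕ} (f : ℝ → (Fin n → ℝ) → (Fin m → ℝ) → (Fin n → ℝ))
    (K : Set (Fin m → ℝ)) (T : ℝ) (q₀ : Fin n → ℝ) : Set (Fin n → ℝ) :=
  {x | ∃ (q : ℝ → (Fin n → ℝ)) (w : ℝ → (Fin m → ℝ)),
    IsControlSolution f K 0 T q w ∧ q 0 = q₀ ∧ q T = x}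

/-- The set of states reachable from `q₀` within time `T` by piecewise real analytic solutions,
together with `q₀` itself. -/
def reachWithin {n m : ℕ} (f : ℝ → (Fin n → ℝ) → (Fin m → ℝ) → (Fin n → ℝ))
    (K : Set (Fin m → ℝ)) (T : ℝ) (q₀ : Fin n → ℝ) : Set (Fin n → ℝ) :=
  {q₀} ∪ ⋃ T' ∈ Ioc 0 T, reachExact f K T' q₀

/-- Hyper-accessibility: for every initial state and every `T > 0`, the set of states reachable in
time exactly `T` is open. -/
def IsHyperAccessible {n m : ℕ} (f : ℝ → (Fin n → ℝ) → (Fin m → ℝ) → (Fin n → ℝ))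
    (K : Set (Fin m → ℝ)) : Prop :=
  ∀ (q₀ : Fin n → ℝ) (T : ℝ), 0 < T → IsOpen (reachExact f K T q₀)

/-- Small-time local controllability at `q₀` in the real analytic sense. -/
def IsSmallTimeLocallyControllableAt {n m : ℕ}
    (f : ℝ → (Fin n → ℝ) → (Fin m → ℝ) → (Fin n → ℝ))
    (K : Set (Fin m → ℝ)) (q₀ : Fin n → ℝ) : Prop :=
  ∃ T : ℝ, 0 < T ∧ reachWithin f K T q₀ ∈ 𝓝 q₀

/-- `q₀` is a state of equilibrium: for some control curve on some interval `[0, T]`, `T > 0`, the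
constant curve at `q₀` is a solution. -/
def IsEquilibriumState {n m : ℕ} (f : ℝ → (Fin n → ℝ) → (Fin m → ℝ) → (Fin n → ℝ))
    (K : Set (Fin m → ℝ)) (q₀ : Fin n → ℝ) : Prop :=
  ∃ (T : ℝ) (w : ℝ → (Fin m → ℝ)), 0 < T ∧ IsControlSolution f K 0 T (fun _ => q₀) w

/-- The right-hand side of the controlled (hydrodynamical) Chaplygin sleigh. The coordinates
`q¹, …, q⁵` and `w¹, w²` are indexed from `0`. -/
noncomputable def chaplyginSleigh (A : ℝ) (_t : ℝ) (q : Fin 5 → ℝ) (w : Fin 2 → ℝ) : Fin 5 → ℝ :=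
  ![q 3 * Real.cos (q 2), q 3 * Real.sin (q 2), q 4, w 0 + A * q 3 * q 4, w 1]

theorem AnalyticAt.exists_primitive {f : ℝ → ℝ} {x : ℝ} (hf : AnalyticAt ℝ f x) :
    ∃ F : ℝ → ℝ, AnalyticAt ℝ F x ∧ ∀ᶠ y in 𝓝 x, HasDerivAt F (f y) y := by
  obtain ⟨p, ρ, hp⟩ := hf
  obtain ⟨r, hr0, hrρ⟩ := ENNReal.lt_iff_exists_nnreal_btwn.1 hp.r_pos
  have hr0' : (0 : ℝ) < r := by exact_mod_cast hr0
  have hsum : Summable fun n => ‖p n‖ * (r : ℝ) ^ n :=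
    p.summable_norm_mul_pow (hrρ.trans_le hp.r_le)
  have hnorm : ∀ n, ‖p n‖ = ‖p.coeff n‖ := fun n => by
    rw [FormalMultilinearSeries.norm_apply_eq_norm_coef]
  simp only [hnorm] at hsum
  set b : ℕ → ℝ := fun n => p.coeff n / (n + 1) with hb
  have hbn : ∀ n, ‖b n‖ ≤ ‖p.coeff n‖ := fun n => by
    have h1 : (1 : ℝ) ≤ |(n : ℝ) + 1| := by
      rw [abs_of_pos (by positivity)]; linarith [(Nat.cast_nonneg n : (0 : ℝ) ≤ n)]
    rw [hb, norm_div, Real.norm_eq_abs ((n : ℝ) + 1)]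
    exact div_le_self (norm_nonneg _) h1
  set s := FormalMultilinearSeries.ofScalars ℝ b with hs
  have hrad : (r : ENNReal) ≤ s.radius := by
    refine s.le_radius_of_summable_norm (Summable.of_nonneg_of_le (fun n => by positivity)
      (fun n => ?_) hsum)
    rw [hs, FormalMultilinearSeries.ofScalars_norm]
    gcongr
    exact hbn n
  have han : AnalyticAt ℝ s.sum 0 :=
    (s.hasFPowerSeriesOnBall (hr0.trans_le hrad)).analyticAt
  refine ⟨fun y => (y - x) * s.sum (y - x), ?_, ?_⟩
  · have h1 : AnalyticAt ℝ (fun y : ℝ => y - x) x := by fun_prop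
    exact h1.mul (AnalyticAt.fun_comp (by simpa using han) h1)
  · filter_upwards [Metric.ball_mem_nhds x hr0'] with y hy
    have key : HasDerivAt (fun z => ∑' n, b n * (z - x) ^ (n + 1))
        (∑' n, p.coeff n * (y - x) ^ n) y := by
      refine hasDerivAt_tsum_of_isPreconnected (g := fun n z => b n * (z - x) ^ (n + 1))
        (g' := fun n z => p.coeff n * (z - x) ^ n) (t := Metric.ball x r) (y₀ := x) hsum
        Metric.isOpen_ball (convex_ball x r).isPreconnected (fun n z hz => ?_) (fun n z hz => ?_)
        (Metric.mem_ball_self hr0') ?_ hy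
      · have := (((hasDerivAt_id z).sub_const x).pow (n + 1)).const_mul (b n)
        have hn : (n : ℝ) + 1 ≠ 0 := by positivity
        refine this.congr_deriv ?_
        simp only [hb, id, Nat.add_sub_cancel]
        push_cast
        field_simp
      · rw [norm_mul, norm_pow]
        gcongr
        exact (mem_ball_iff_norm.1 hz).le
      · simp [summable_zero]
    have e1 : (fun y => (y - x) * s.sum (y - x)) = fun z => ∑' n, b n * (z - x) ^ (n + 1) := by
      funext z
      rw [hs, ← FormalMultilinearSeries.ofScalarsSum, FormalMultilinearSeries.ofScalarsSum_eq_tsum,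
        ← tsum_mul_left]
      exact tsum_congr fun n => by simp only [smul_eq_mul]; ring
    have e2 : ∑' n, p.coeff n * (y - x) ^ n = f y := by
      have hy' : y - x ∈ Metric.eball (0 : ℝ) ρ := by
        rw [Metric.mem_eball, edist_zero_right]
        refine lt_trans ?_ hrρ
        rw [enorm_eq_nnnorm]
        exact_mod_cast (mem_ball_iff_norm.1 hy)
      have := (hp.hasSum hy').tsum_eq
      rw [add_sub_cancel] at this
      rw [← this]
      exact tsum_congr fun n => by
        rw [FormalMultilinearSeries.apply_eq_pow_smul_coeff, smul_eq_mul, mul_comm]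
    rw [e1, ← e2]
    exact key

theorem LipschitzOnWith.concat {E : Type*} [PseudoMetricSpace E] {f : ℝ → E} {K : NNReal}
    {a b c : ℝ} (h₁ : LipschitzOnWith K f (Icc a b))
    (h₂ : LipschitzOnWith K f (Icc b c)) (hab : a ≤ b) (hbc : b ≤ c) :
    LipschitzOnWith K f (Icc a c) := by
  have key : ∀ x ∈ Icc a c, ∀ y ∈ Icc a c, x ≤ y → dist (f x) (f y) ≤ K * dist x y := by
    intro x hx y hy hxy
    rcases le_total y b with hyb | hyb
    · exact h₁.dist_le_mul x ⟨hx.1, hxy.trans hyb⟩ y ⟨hy.1, hyb⟩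
    rcases le_total b x with hxb | hxb
    · exact h₂.dist_le_mul x ⟨hxb, hx.2⟩ y ⟨hyb, hy.2⟩
    have e1 := h₁.dist_le_mul x ⟨hx.1, hxb⟩ b ⟨hab, le_rfl⟩
    have e2 := h₂.dist_le_mul b ⟨le_rfl, hbc⟩ y ⟨hyb, hy.2⟩
    refine (dist_triangle _ (f b) _).trans ((add_le_add e1 e2).trans_eq ?_)
    rw [← mul_add]
    simp only [Real.dist_eq, abs_of_nonpos (sub_nonpos.2 hxb), abs_of_nonpos (sub_nonpos.2 hyb),
      abs_of_nonpos (sub_nonpos.2 hxy)]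
    ring
  refine LipschitzOnWith.of_dist_le_mul fun x hx y hy => ?_
  rcases le_total x y with h | h
  · exact key x hx y hy h
  · rw [dist_comm, dist_comm x]; exact key y hy x hx h

/-- `γ` agrees to the right of `t` with a map which is real analytic at `t`. -/
def RightAnalyticAt {E : Type*} [NormedAddCommGroup E] [NormedSpace ℝ E] (γ : ℝ → E) (t : ℝ) :
    Prop :=
  ∃ g : ℝ → E, AnalyticAt ℝ g t ∧ γ =ᶠ[𝓝[>] t] g

/-- `γ` agrees to the left of `t` with a map which is real analytic at `t`. -/
def LeftAnalyticAt {E : Type*} [NormedAddCommGroup E] [NormedSpace ℝ E] (γ : ℝ → E) (t : ℝ) :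
    Prop :=
  ∃ g : ℝ → E, AnalyticAt ℝ g t ∧ γ =ᶠ[𝓝[<] t] g

section germs

variable {E : Type*} [NormedAddCommGroup E] [NormedSpace ℝ E] {γ γ' : ℝ → E} {a b c t u : ℝ}

theorem AnalyticAt.rightAnalyticAt (h : AnalyticAt ℝ γ t) : RightAnalyticAt γ t :=
  ⟨γ, h, .rfl⟩

theorem AnalyticAt.leftAnalyticAt (h : AnalyticAt ℝ γ t) : LeftAnalyticAt γ t :=
  ⟨γ, h, .rfl⟩

theorem RightAnalyticAt.congr (h : RightAnalyticAt γ t) (e : γ' =ᶠ[𝓝[>] t] γ) :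
    RightAnalyticAt γ' t :=
  let ⟨g, hg, hγ⟩ := h
  ⟨g, hg, e.trans hγ⟩

theorem LeftAnalyticAt.congr (h : LeftAnalyticAt γ t) (e : γ' =ᶠ[𝓝[<] t] γ) :
    LeftAnalyticAt γ' t :=
  let ⟨g, hg, hγ⟩ := h
  ⟨g, hg, e.trans hγ⟩

theorem exists_index_Ico {τ : ℕ → ℝ} (h0 : τ 0 ≤ t) :
    ∀ n, t < τ n → ∃ i < n, t ∈ Ico (τ i) (τ (i + 1))
  | 0, h => absurd h0 (not_le.2 h)
  | n + 1, h => by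
    rcases lt_or_ge t (τ n) with h' | h'
    · obtain ⟨i, hi, hit⟩ := exists_index_Ico h0 n h'
      exact ⟨i, hi.trans n.lt_succ_self, hit⟩
    · exact ⟨n, n.lt_succ_self, h', h⟩

theorem exists_index_Ioc {τ : ℕ → ℝ} (h0 : τ 0 < t) :
    ∀ n, t ≤ τ n → ∃ i < n, t ∈ Ioc (τ i) (τ (i + 1))
  | 0, h => absurd h0 (not_lt.2 h)
  | n + 1, h => by
    rcases le_or_gt t (τ n) with h' | h'
    · obtain ⟨i, hi, hit⟩ := exists_index_Ioc h0 n h'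
      exact ⟨i, hi.trans n.lt_succ_self, hit⟩
    · exact ⟨n, n.lt_succ_self, h', h⟩

theorem IsPiecewiseAnalyticOn.rightAnalyticAt (h : IsPiecewiseAnalyticOn γ a b)
    (ht : t ∈ Ico a b) : RightAnalyticAt γ t := by
  obtain ⟨r, τ, rfl, rfl, hτ⟩ := h
  obtain ⟨i, hi, hit⟩ := exists_index_Ico ht.1 r ht.2
  obtain ⟨-, g, hg, hγ⟩ := hτ i hi
  refine ⟨g, hg t (Ico_subset_Icc_self hit), ?_⟩
  filter_upwards [Ioo_mem_nhdsGT hit.2] with s hs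
  exact hγ ⟨hit.1.trans_lt hs.1, hs.2⟩

theorem IsPiecewiseAnalyticOn.leftAnalyticAt (h : IsPiecewiseAnalyticOn γ a b)
    (ht : t ∈ Ioc a b) : LeftAnalyticAt γ t := by
  obtain ⟨r, τ, rfl, rfl, hτ⟩ := h
  obtain ⟨i, hi, hit⟩ := exists_index_Ioc ht.1 r ht.2
  obtain ⟨-, g, hg, hγ⟩ := hτ i hi
  refine ⟨g, hg t (Ioc_subset_Icc_self hit), ?_⟩
  filter_upwards [Ioo_mem_nhdsLT hit.1] with s hs
  exact hγ ⟨hs.1, hs.2.trans_le hit.2⟩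

theorem IsPiecewiseAnalyticOn.le (h : IsPiecewiseAnalyticOn γ a b) : a ≤ b := by
  obtain ⟨r, τ, rfl, rfl, hτ⟩ := h
  have : ∀ n ≤ r, τ 0 ≤ τ n := fun n => by
    induction n with
    | zero => exact fun _ => le_rfl
    | succ n ih => exact fun hn => (ih (by omega)).trans (hτ n (by omega)).1.le
  exact this r le_rfl

theorem IsPiecewiseAnalyticOn.append (h : IsPiecewiseAnalyticOn γ a t) (htu : t < u)
    {g : ℝ → E} (hg : AnalyticOnNhd ℝ g (Icc t u)) (hγ : EqOn γ g (Ioo t u)) :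
    IsPiecewiseAnalyticOn γ a u := by
  obtain ⟨r, τ, rfl, rfl, hτ⟩ := h
  refine ⟨r + 1, fun i => if i ≤ r then τ i else u, by simp, by simp, fun i hi => ?_⟩
  rcases (Nat.lt_succ_iff.1 hi).lt_or_eq with hi' | rfl
  · simpa [hi'.le, Nat.succ_le_of_lt hi'] using hτ i hi'
  · simpa using ⟨htu, g, hg, hγ⟩

theorem IsPiecewiseAnalyticOn.exists_lipschitzOnWith (h : IsPiecewiseAnalyticOn γ a b)
    (hc : ContinuousOn γ (Icc a b)) : ∃ K, LipschitzOnWith K γ (Icc a b) := by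
  obtain ⟨r, τ, rfl, rfl, hτ⟩ := h
  have hmono : ∀ n ≤ r, ∀ m ≤ n, τ m ≤ τ n := fun n => by
    induction n with
    | zero => intro _ m hm; rw [Nat.le_zero.1 hm]
    | succ n ih =>
      intro hn m hm
      rcases hm.eq_or_lt with rfl | hm
      · rfl
      · exact (ih (by omega) m (by omega)).trans (hτ n (by omega)).1.le
  have : ∀ n ≤ r, ∃ K, LipschitzOnWith K γ (Icc (τ 0) (τ n)) := fun n => by
    induction n with
    | zero =>
      refine fun _ => ⟨0, LipschitzOnWith.of_dist_le_mul fun x hx y hy => ?_⟩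
      rw [Icc_self, mem_singleton_iff] at hx hy
      simp [hx, hy]
    | succ n ih =>
      intro hn
      obtain ⟨K₁, hK₁⟩ := ih (by omega)
      obtain ⟨hlt, g, hg, hγ⟩ := hτ n (by omega)
      obtain ⟨K₂, hK₂⟩ := LocallyLipschitzOn.exists_lipschitzOnWith_of_compact isCompact_Icc
        (f := g) (s := Icc (τ n) (τ (n + 1))) fun x hx => by
          obtain ⟨K, s, hs, hl⟩ := (hg x hx).hasStrictFDerivAt.exists_lipschitzOnWith
          exact ⟨K, s, mem_nhdsWithin_of_mem_nhds hs, hl⟩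
      have heq : EqOn γ g (Icc (τ n) (τ (n + 1))) := by
        refine hγ.of_subset_closure (hc.mono ?_) hg.continuousOn Ioo_subset_Icc_self ?_
        · exact Icc_subset_Icc (hmono n (by omega) 0 (by omega)) (hmono r le_rfl _ hn)
        · rw [closure_Ioo hlt.ne]
      refine ⟨max K₁ K₂, (hK₁.weaken (le_max_left _ _)).concat (fun x hx y hy => ?_)
        (hmono n (by omega) 0 (by omega)) hlt.le⟩
      rw [heq hx, heq hy]
      exact hK₂.weaken (le_max_right _ _) hx hy
  exact this r le_rfl

variable [CompleteSpace E]

/-- An analytic germ is analytic on a compact neighbourhood. -/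
theorem exists_analyticOnNhd_Icc {g : ℝ → E} (hg : AnalyticAt ℝ g t) :
    ∃ ε > 0, AnalyticOnNhd ℝ g (Icc (t - ε) (t + ε)) := by
  obtain ⟨ε, hε, h⟩ := Metric.nhds_basis_closedBall.eventually_iff.1 hg.eventually_analyticAt
  exact ⟨ε, hε, fun s hs => h (by rwa [Real.closedBall_eq_Icc])⟩

theorem RightAnalyticAt.exists_Icc (h : RightAnalyticAt γ t) (htu : t < u) :
    ∃ s ∈ Ioc t u, ∃ g : ℝ → E, AnalyticOnNhd ℝ g (Icc t s) ∧ EqOn γ g (Ioo t s) := by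
  obtain ⟨g, hg, hγ⟩ := h
  obtain ⟨ε, hε, hgε⟩ := exists_analyticOnNhd_Icc hg
  obtain ⟨s, hs, hγs⟩ := (mem_nhdsGT_iff_exists_Ioo_subset).1 hγ
  refine ⟨min (min s u) (t + ε), ⟨?_, ?_⟩, g, hgε.mono ?_, fun x hx => hγs ?_⟩
  · simp only [lt_min_iff]; exact ⟨⟨hs, htu⟩, by linarith⟩
  · exact (min_le_left _ _).trans (min_le_right _ _)
  · exact Icc_subset_Icc (by linarith) (min_le_right _ _)
  · exact ⟨hx.1, hx.2.trans_le ((min_le_left _ _).trans (min_le_left _ _))⟩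

theorem LeftAnalyticAt.exists_lt (h : LeftAnalyticAt γ t) :
    ∃ l < t, ∃ g : ℝ → E, AnalyticOnNhd ℝ g (Icc l t) ∧ EqOn γ g (Ioo l t) := by
  obtain ⟨g, hg, hγ⟩ := h
  obtain ⟨ε, hε, hgε⟩ := exists_analyticOnNhd_Icc hg
  obtain ⟨s, hs, hγs⟩ := (mem_nhdsLT_iff_exists_Ioo_subset).1 hγ
  refine ⟨max s (t - ε), ?_, g, hgε.mono ?_, fun x hx => hγs ?_⟩
  · simp only [max_lt_iff]; exact ⟨hs, by linarith⟩
  · exact Icc_subset_Icc (le_max_right _ _) (by linarith)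
  · exact ⟨(le_max_left _ _).trans_lt hx.1, hx.2⟩

theorem isPiecewiseAnalyticOn_of_germs (hab : a ≤ b) (hr : ∀ t ∈ Ico a b, RightAnalyticAt γ t)
    (hl : ∀ t ∈ Ioc a b, LeftAnalyticAt γ t) : IsPiecewiseAnalyticOn γ a b := by
  set S := {t | t ∈ Icc a b ∧ IsPiecewiseAnalyticOn γ a t} with hS
  have haS : a ∈ S := ⟨left_mem_Icc.2 hab, 0, fun _ => a, rfl, rfl, by simp⟩
  have hbdd : BddAbove S := ⟨b, fun t ht => ht.1.2⟩
  have hac : a ≤ sSup S := le_csSup hbdd haS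
  have hcb : sSup S ≤ b := csSup_le ⟨a, haS⟩ fun t ht => ht.1.2
  have hcS : sSup S ∈ S := by
    rcases hac.eq_or_lt with hac' | hac'
    · exact hac' ▸ haS
    · obtain ⟨l, hl', g, hg, hγ⟩ := (hl _ ⟨hac', hcb⟩).exists_lt
      obtain ⟨t, ht, hlt⟩ := exists_lt_of_lt_csSup ⟨a, haS⟩ hl'
      rcases (le_csSup hbdd ht).eq_or_lt with htc | htc
      · exact htc ▸ ht
      · exact ⟨⟨hac, hcb⟩, ht.2.append htc (hg.mono (Icc_subset_Icc_left hlt.le))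
          (hγ.mono (Ioo_subset_Ioo_left hlt.le))⟩
  rcases hcb.eq_or_lt with hcb' | hcb'
  · exact hcb' ▸ hcS.2
  · obtain ⟨s, hs, g, hg, hγ⟩ := (hr _ ⟨hac, hcb'⟩).exists_Icc hcb'
    have : s ∈ S := ⟨⟨hac.trans hs.1.le, hs.2⟩, hcS.2.append hs.1 hg hγ⟩
    exact absurd (le_csSup hbdd this) (not_le.2 hs.1)

theorem IsPiecewiseAnalyticOn.mono (h : IsPiecewiseAnalyticOn γ a b) {a' b' : ℝ} (ha : a ≤ a')
    (hab : a' ≤ b') (hb : b' ≤ b) : IsPiecewiseAnalyticOn γ a' b' :=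
  isPiecewiseAnalyticOn_of_germs hab
    (fun _ ht => h.rightAnalyticAt ⟨ha.trans ht.1, ht.2.trans_le hb⟩)
    fun _ ht => h.leftAnalyticAt ⟨ha.trans_lt ht.1, ht.2.trans hb⟩

theorem IsPiecewiseAnalyticOn.congr (h : IsPiecewiseAnalyticOn γ a b)
    (e : EqOn γ' γ (Ioo a b)) : IsPiecewiseAnalyticOn γ' a b := by
  refine isPiecewiseAnalyticOn_of_germs h.le (fun t ht => (h.rightAnalyticAt ht).congr ?_)
    fun t ht => (h.leftAnalyticAt ht).congr ?_
  · filter_upwards [Ioo_mem_nhdsGT ht.2] with s hs using e ⟨ht.1.trans_lt hs.1, hs.2⟩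
  · filter_upwards [Ioo_mem_nhdsLT ht.1] with s hs using e ⟨hs.1, hs.2.trans_le ht.2⟩

theorem IsPiecewiseAnalyticOn.concat (h₁ : IsPiecewiseAnalyticOn γ a b)
    (h₂ : IsPiecewiseAnalyticOn γ b c) (hab : a ≤ b) (hbc : b ≤ c) :
    IsPiecewiseAnalyticOn γ a c := by
  refine isPiecewiseAnalyticOn_of_germs (hab.trans hbc) (fun t ht => ?_) fun t ht => ?_
  · rcases lt_or_ge t b with h | h
    · exact h₁.rightAnalyticAt ⟨ht.1, h⟩
    · exact h₂.rightAnalyticAt ⟨h, ht.2⟩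
  · rcases le_or_gt t b with h | h
    · exact h₁.leftAnalyticAt ⟨ht.1, h⟩
    · exact h₂.leftAnalyticAt ⟨h, ht.2⟩

theorem AnalyticOnNhd.isPiecewiseAnalyticOn (hab : a ≤ b) (h : AnalyticOnNhd ℝ γ (Icc a b)) :
    IsPiecewiseAnalyticOn γ a b :=
  isPiecewiseAnalyticOn_of_germs hab (fun t ht => (h t (Ico_subset_Icc_self ht)).rightAnalyticAt)
    fun t ht => (h t (Ioc_subset_Icc_self ht)).leftAnalyticAt

end germs

section controlSolution

variable {n m : ℕ} {f : ℝ → (Fin n → ℝ) → (Fin m → ℝ) → (Fin n → ℝ)} {K : Set (Fin m → ℝ)}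
  {a b c : ℝ} {q q₁ q₂ : ℝ → (Fin n → ℝ)} {w w₁ w₂ : ℝ → (Fin m → ℝ)}

theorem IsControlSolution.of_continuousOn (hab : a ≤ b) (hwK : ∀ t ∈ Icc a b, w t ∈ K)
    (hw : IsPiecewiseAnalyticOn w a b) (hq : IsPiecewiseAnalyticOn q a b)
    (hc : ContinuousOn q (Icc a b))
    (he : ∀ᵐ t : ℝ, t ∈ Icc a b → HasDerivAt q (f t (q t) (w t)) t) :
    IsControlSolution f K a b q w :=
  ⟨hwK, hw, hq, by
    obtain ⟨C, hC⟩ := hq.exists_lipschitzOnWith hc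
    exact LipschitzOnWith.absolutelyContinuousOnInterval (by rwa [uIcc_of_le hab]), he⟩

theorem IsControlSolution.continuousOn (h : IsControlSolution f K a b q w) (hab : a ≤ b) :
    ContinuousOn q (Icc a b) := by
  simpa [uIcc_of_le hab] using h.state_absCont.continuousOn

theorem IsControlSolution.mono (h : IsControlSolution f K a b q w) {a' b' : ℝ} (ha : a ≤ a')
    (hab : a' ≤ b') (hb : b' ≤ b) : IsControlSolution f K a' b' q w := by
  have hs : Icc a' b' ⊆ Icc a b := Icc_subset_Icc ha hb
  refine .of_continuousOn hab (fun t ht => h.control_mem t (hs ht))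
    (h.control_analytic.mono ha hab hb) (h.state_analytic.mono ha hab hb)
    ((h.continuousOn (ha.trans (hab.trans hb))).mono hs) ?_
  filter_upwards [h.equation] with t ht ht' using ht (hs ht')

theorem IsPiecewiseAnalyticOn.ite_le {E : Type*} [NormedAddCommGroup E] [NormedSpace ℝ E]
    [CompleteSpace E] {γ₁ γ₂ : ℝ → E} (h₁ : IsPiecewiseAnalyticOn γ₁ a b)
    (h₂ : IsPiecewiseAnalyticOn γ₂ b c) (hab : a ≤ b) (hbc : b ≤ c) :
    IsPiecewiseAnalyticOn (fun t => if t ≤ b then γ₁ t else γ₂ t) a c :=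
  (h₁.congr fun _ ht => if_pos ht.2.le).concat (h₂.congr fun _ ht => if_neg (not_le.2 ht.1))
    hab hbc

theorem IsControlSolution.concat (h₁ : IsControlSolution f K a b q₁ w₁)
    (h₂ : IsControlSolution f K b c q₂ w₂) (hab : a ≤ b) (hbc : b ≤ c) (hq : q₁ b = q₂ b) :
    IsControlSolution f K a c (fun t => if t ≤ b then q₁ t else q₂ t)
      (fun t => if t ≤ b then w₁ t else w₂ t) := by
  refine .of_continuousOn (hab.trans hbc) (fun t ht => ?_)
    (h₁.control_analytic.ite_le h₂.control_analytic hab hbc)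
    (h₁.state_analytic.ite_le h₂.state_analytic hab hbc) ?_ ?_
  · split_ifs with h
    · exact h₁.control_mem t ⟨ht.1, h⟩
    · exact h₂.control_mem t ⟨(not_le.1 h).le, ht.2⟩
  · rw [← Icc_union_Icc_eq_Icc hab hbc]
    refine ContinuousOn.union_of_isClosed ?_ ?_ isClosed_Icc isClosed_Icc
    · exact (h₁.continuousOn hab).congr fun t ht => if_pos ht.2
    · refine (h₂.continuousOn hbc).congr fun t ht => ?_
      rcases ht.1.eq_or_lt with rfl | h
      · simpa using hq
      · exact if_neg (not_le.2 h)
  · have hne : ∀ᵐ t : ℝ, t ≠ b := by simp [ae_iff]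
    filter_upwards [h₁.equation, h₂.equation, hne] with t e₁ e₂ hne ht
    rcases hne.lt_or_gt with h | h
    · simp only [if_pos h.le]
      refine (e₁ ⟨ht.1, h.le⟩).congr_of_eventuallyEq ?_
      filter_upwards [Iio_mem_nhds h] with s hs using if_pos (le_of_lt hs)
    · simp only [if_neg (not_le.2 h)]
      refine (e₂ ⟨h.le, ht.2⟩).congr_of_eventuallyEq ?_
      filter_upwards [Ioi_mem_nhds h] with s hs using if_neg (not_le.2 hs)

end controlSolution

/-- The states which can be reached at time `b` from the state `x` at time `a`. -/
def reachBetween {n m : ℕ} (f : ℝ → (Fin n → ℝ) → (Fin m → ℝ) → (Fin n → ℝ))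
    (K : Set (Fin m → ℝ)) (a b : ℝ) (x : Fin n → ℝ) : Set (Fin n → ℝ) :=
  {y | ∃ (q : ℝ → (Fin n → ℝ)) (w : ℝ → (Fin m → ℝ)),
    IsControlSolution f K a b q w ∧ q a = x ∧ q b = y}

theorem reachBetween_trans {n m : ℕ} {f : ℝ → (Fin n → ℝ) → (Fin m → ℝ) → (Fin n → ℝ)}
    {K : Set (Fin m → ℝ)} {a b c : ℝ} {x y z : Fin n → ℝ} (hab : a ≤ b) (hbc : b < c)
    (h₁ : y ∈ reachBetween f K a b x) (h₂ : z ∈ reachBetween f K b c y) :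
    z ∈ reachBetween f K a c x := by
  obtain ⟨q₁, w₁, s₁, rfl, rfl⟩ := h₁
  obtain ⟨q₂, w₂, s₂, e, rfl⟩ := h₂
  exact ⟨_, _, s₁.concat s₂ hab hbc.le e.symm, by simp [hab], by simp [hbc]⟩

section sleigh

variable {A : ℝ} {K : Set (Fin 2 → ℝ)} {a b : ℝ} {q : ℝ → (Fin 5 → ℝ)} {w : ℝ → (Fin 2 → ℝ)}

theorem ContinuousOn.chaplyginSleigh {s : Set ℝ} (hq : ContinuousOn q s) (hw : ContinuousOn w s) :
    ContinuousOn (fun t => chaplyginSleigh A t (q t) (w t)) s := by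
  have hq' : ∀ i, ContinuousOn (fun t => q t i) s := continuousOn_pi.1 hq
  have hw' : ∀ i, ContinuousOn (fun t => w t i) s := continuousOn_pi.1 hw
  refine continuousOn_pi.2 fun i => ?_
  have h2 := hq' 2; have h3 := hq' 3; have h4 := hq' 4
  have k0 := hw' 0; have k1 := hw' 1
  fin_cases i <;> simp [_root_.chaplyginSleigh] <;> fun_prop

/-- In every time interval there is a subinterval on which a solution is analytic and satisfies the
equation at every time. -/
theorem IsControlSolution.exists_regular_Icc
    (h : IsControlSolution (chaplyginSleigh A) K a b q w) {t u : ℝ} (hat : a ≤ t) (htu : t < u)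
    (hub : u ≤ b) : ∃ a' b', t < a' ∧ a' < b' ∧ b' < u ∧ AnalyticOnNhd ℝ q (Icc a' b') ∧
      AnalyticOnNhd ℝ w (Icc a' b') ∧
      ∀ s ∈ Icc a' b', HasDerivAt q (chaplyginSleigh A s (q s) (w s)) s := by
  have ht : t ∈ Ico a b := ⟨hat, htu.trans_le hub⟩
  obtain ⟨s₁, hs₁, g, hg, hqg⟩ := (h.state_analytic.rightAnalyticAt ht).exists_Icc htu
  obtain ⟨s₂, hs₂, k, hk, hwk⟩ := (h.control_analytic.rightAnalyticAt ht).exists_Icc hs₁.1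
  have hq' : AnalyticOnNhd ℝ q (Ioo t s₂) := fun x hx =>
    (hg x ⟨hx.1.le, (hx.2.trans_le hs₂.2).le⟩).congr (by
      filter_upwards [Ioo_mem_nhds hx.1 (hx.2.trans_le hs₂.2)] with y hy using (hqg hy).symm)
  have hw' : AnalyticOnNhd ℝ w (Ioo t s₂) := fun x hx =>
    (hk x ⟨hx.1.le, hx.2.le⟩).congr (by
      filter_upwards [Ioo_mem_nhds hx.1 hx.2] with y hy using (hwk hy).symm)
  have heq : EqOn (deriv q) (fun s => chaplyginSleigh A s (q s) (w s)) (Ioo t s₂) := by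
    refine Measure.eqOn_open_of_ae_eq (μ := volume) ?_ isOpen_Ioo hq'.deriv.continuousOn
      (hq'.continuousOn.chaplyginSleigh hw'.continuousOn)
    rw [Filter.EventuallyEq, ae_restrict_iff' measurableSet_Ioo]
    filter_upwards [h.equation] with s hs hs'
    exact (hs ⟨hat.trans hs'.1.le, hs'.2.le.trans (hs₂.2.trans (hs₁.2.trans hub))⟩).deriv
  have h₁ := hs₁.2
  have h₂ := hs₂.1
  have h₃ := hs₂.2
  have hsub : Icc (t + (s₂ - t) / 3) (t + 2 * (s₂ - t) / 3) ⊆ Ioo t s₂ := fun x hx =>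
    ⟨by linarith [hx.1], by linarith [hx.2]⟩
  refine ⟨t + (s₂ - t) / 3, t + 2 * (s₂ - t) / 3, by linarith, by linarith, by linarith,
    hq'.mono hsub, hw'.mono hsub, fun s hs => ?_⟩
  exact (hq' s (hsub hs)).differentiableAt.hasDerivAt.congr_deriv (heq (hsub hs))

end sleigh

section closure

variable {E F : Type*} [NormedAddCommGroup E] [NormedSpace ℝ E] [NormedAddCommGroup F]
  [NormedSpace ℝ F] {a b : ℝ}

theorem IsPiecewiseAnalyticOn.comp_left [CompleteSpace F] {γ : ℝ → E} {φ : E → F}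
    (hφ : ∀ x, AnalyticAt ℝ φ x) (h : IsPiecewiseAnalyticOn γ a b) :
    IsPiecewiseAnalyticOn (fun t => φ (γ t)) a b :=
  isPiecewiseAnalyticOn_of_germs h.le
    (fun t ht => by
      obtain ⟨g, hg, e⟩ := h.rightAnalyticAt ht
      exact ⟨fun t => φ (g t), (hφ _).fun_comp hg, e.fun_comp φ⟩)
    (fun t ht => by
      obtain ⟨g, hg, e⟩ := h.leftAnalyticAt ht
      exact ⟨fun t => φ (g t), (hφ _).fun_comp hg, e.fun_comp φ⟩)

theorem IsPiecewiseAnalyticOn.pi [CompleteSpace E] {ι : Type*} [Fintype ι] {γ : ℝ → ι → E}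
    (hab : a ≤ b) (h : ∀ i, IsPiecewiseAnalyticOn (fun t => γ t i) a b) :
    IsPiecewiseAnalyticOn γ a b := by
  refine isPiecewiseAnalyticOn_of_germs hab (fun t ht => ?_) fun t ht => ?_
  · choose g hg e using fun i => (h i).rightAnalyticAt ht
    refine ⟨fun t i => g i t, .pi hg, ?_⟩
    filter_upwards [Filter.eventually_all.2 e] with s hs using funext hs
  · choose g hg e using fun i => (h i).leftAnalyticAt ht
    refine ⟨fun t i => g i t, .pi hg, ?_⟩
    filter_upwards [Filter.eventually_all.2 e] with s hs using funext hs

theorem IsPiecewiseAnalyticOn.prodMk [CompleteSpace E] [CompleteSpace F] {γ : ℝ → E} {δ : ℝ → F}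
    (h : IsPiecewiseAnalyticOn γ a b) (h' : IsPiecewiseAnalyticOn δ a b) :
    IsPiecewiseAnalyticOn (fun t => (γ t, δ t)) a b := by
  refine isPiecewiseAnalyticOn_of_germs h.le (fun t ht => ?_) fun t ht => ?_
  · obtain ⟨g, hg, e⟩ := h.rightAnalyticAt ht
    obtain ⟨g', hg', e'⟩ := h'.rightAnalyticAt ht
    exact ⟨_, hg.prod hg', e.prodMk e'⟩
  · obtain ⟨g, hg, e⟩ := h.leftAnalyticAt ht
    obtain ⟨g', hg', e'⟩ := h'.leftAnalyticAt ht
    exact ⟨_, hg.prod hg', e.prodMk e'⟩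

theorem IsPiecewiseAnalyticOn.mul {γ δ : ℝ → ℝ} (h : IsPiecewiseAnalyticOn γ a b)
    (h' : IsPiecewiseAnalyticOn δ a b) : IsPiecewiseAnalyticOn (fun t => γ t * δ t) a b :=
  (h.prodMk h').comp_left (φ := fun p : ℝ × ℝ => p.1 * p.2) fun _ =>
    analyticAt_fst.mul analyticAt_snd

theorem IsPiecewiseAnalyticOn.add {γ δ : ℝ → ℝ} (h : IsPiecewiseAnalyticOn γ a b)
    (h' : IsPiecewiseAnalyticOn δ a b) : IsPiecewiseAnalyticOn (fun t => γ t + δ t) a b :=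
  (h.prodMk h').comp_left (φ := fun p : ℝ × ℝ => p.1 + p.2) fun _ =>
    analyticAt_fst.add analyticAt_snd

theorem IsPiecewiseAnalyticOn.sub {γ δ : ℝ → ℝ} (h : IsPiecewiseAnalyticOn γ a b)
    (h' : IsPiecewiseAnalyticOn δ a b) : IsPiecewiseAnalyticOn (fun t => γ t - δ t) a b :=
  (h.prodMk h').comp_left (φ := fun p : ℝ × ℝ => p.1 - p.2) fun _ =>
    analyticAt_fst.sub analyticAt_snd

theorem IsPiecewiseAnalyticOn.intervalIntegral {G : ℝ → ℝ} (hG : Continuous G)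
    (h : IsPiecewiseAnalyticOn G a b) (c : ℝ) :
    IsPiecewiseAnalyticOn (fun t => ∫ s in c..t, G s) a b := by
  have hi : ∀ x y, IntervalIntegrable G volume x y := fun x y => hG.intervalIntegrable x y
  refine isPiecewiseAnalyticOn_of_germs h.le (fun t ht => ?_) fun t ht => ?_
  · obtain ⟨g, hg, e⟩ := h.rightAnalyticAt ht
    obtain ⟨P, hP, hP'⟩ := hg.exists_primitive
    refine ⟨fun u => (∫ s in c..t, G s) + (P u - P t), by fun_prop, ?_⟩
    obtain ⟨ε, hε, hPε⟩ := Metric.eventually_nhds_iff_ball.1 hP'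
    obtain ⟨u, hu, hγ⟩ := (mem_nhdsGT_iff_exists_Ioo_subset).1 e
    filter_upwards [Ioo_mem_nhdsGT (show t < min u (t + ε) by
      simp only [lt_min_iff]; exact ⟨hu, by linarith⟩)] with x hx
    have hxu := hx.2.trans_le (min_le_left _ _)
    have hxε := hx.2.trans_le (min_le_right _ _)
    have hd : ∀ y ∈ Icc t x, HasDerivAt P (g y) y := fun y hy => hPε y (by
      rw [Real.ball_eq_Ioo]; exact ⟨by linarith [hy.1], by linarith [hy.2]⟩)
    rw [← intervalIntegral.integral_add_adjacent_intervals (hi c t) (hi t x),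
      intervalIntegral.integral_eq_sub_of_hasDerivAt_of_le hx.1.le
        (fun y hy => (hd y hy).continuousAt.continuousWithinAt) (fun y hy => ?_) (hi t x)]
    rw [show G y = g y from hγ ⟨hy.1, hy.2.trans hxu⟩]
    exact hd y (Ioo_subset_Icc_self hy)
  · obtain ⟨g, hg, e⟩ := h.leftAnalyticAt ht
    obtain ⟨P, hP, hP'⟩ := hg.exists_primitive
    refine ⟨fun u => (∫ s in c..t, G s) - (P t - P u), by fun_prop, ?_⟩
    obtain ⟨ε, hε, hPε⟩ := Metric.eventually_nhds_iff_ball.1 hP'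
    obtain ⟨u, hu, hγ⟩ := (mem_nhdsLT_iff_exists_Ioo_subset).1 e
    filter_upwards [Ioo_mem_nhdsLT (show max u (t - ε) < t by
      simp only [max_lt_iff]; exact ⟨hu, by linarith⟩)] with x hx
    have hxu := (le_max_left _ _).trans_lt hx.1
    have hxε := (le_max_right _ _).trans_lt hx.1
    have hd : ∀ y ∈ Icc x t, HasDerivAt P (g y) y := fun y hy => hPε y (by
      rw [Real.ball_eq_Ioo]; exact ⟨by linarith [hy.1], by linarith [hy.2]⟩)
    rw [eq_sub_iff_add_eq, ← intervalIntegral.integral_eq_sub_of_hasDerivAt_of_le hx.2.le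
        (fun y hy => (hd y hy).continuousAt.continuousWithinAt) (fun y hy => ?_) (hi x t),
        intervalIntegral.integral_add_adjacent_intervals (hi c x) (hi x t)]
    rw [show G y = g y from hγ ⟨hxu.trans hy.1, hy.2⟩]
    exact hd y (Ioo_subset_Icc_self hy)

end closure

section transport

/-- Heading of the solution obtained from `Q` by displacing its end point at time `T` by `δ`. -/
noncomputable def displacedHeading (T : ℝ) (Q : ℝ → Fin 5 → ℝ) (δ : Fin 5 → ℝ) (t : ℝ) : ℝ :=
  Q t 2 + δ 2 + δ 4 * (t - T)

/-- Speed of the solution obtained from `Q` by displacing its end point at time `T` by `δ`. -/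
noncomputable def displacedSpeed (A T : ℝ) (Q : ℝ → Fin 5 → ℝ) (δ : Fin 5 → ℝ) (t : ℝ) : ℝ :=
  Q t 3 + Real.exp (A * displacedHeading T Q δ t) *
    (Real.exp (-(A * displacedHeading T Q δ T)) * δ 3 +
      A * δ 4 * ∫ s in T..t, Q s 3 * Real.exp (-(A * displacedHeading T Q δ s)))

/-- The solution obtained from `Q` by displacing its end point at time `T` by `δ`, with the same
controls. -/
noncomputable def displaced (A T : ℝ) (Q : ℝ → Fin 5 → ℝ) (δ : Fin 5 → ℝ) (t : ℝ) : Fin 5 → ℝ :=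
  ![Q t 0 + δ 0 + ∫ s in T..t, (displacedSpeed A T Q δ s * Real.cos (displacedHeading T Q δ s) -
      Q s 3 * Real.cos (Q s 2)),
    Q t 1 + δ 1 + ∫ s in T..t, (displacedSpeed A T Q δ s * Real.sin (displacedHeading T Q δ s) -
      Q s 3 * Real.sin (Q s 2)),
    displacedHeading T Q δ t, displacedSpeed A T Q δ t, Q t 4 + δ 4]

variable {A T : ℝ} {Q : ℝ → Fin 5 → ℝ}

theorem continuous_displacedHeading (hQ : Continuous Q) :
    Continuous fun p : (Fin 5 → ℝ) × ℝ => displacedHeading T Q p.1 p.2 := by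
  unfold displacedHeading
  fun_prop

theorem continuous_displacedSpeed (hQ : Continuous Q) :
    Continuous fun p : (Fin 5 → ℝ) × ℝ => displacedSpeed A T Q p.1 p.2 := by
  have h := continuous_displacedHeading (T := T) hQ
  have h1 : Continuous fun p : (Fin 5 → ℝ) × ℝ => displacedHeading T Q p.1 T :=
    h.comp (continuous_fst.prodMk continuous_const)
  have h2 : Continuous fun p : (Fin 5 → ℝ) × ℝ =>
      ∫ s in T..p.2, Q s 3 * Real.exp (-(A * displacedHeading T Q p.1 s)) := by
    refine intervalIntegral.continuous_parametric_intervalIntegral_of_continuous ?_ continuous_snd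
    have h3 : Continuous fun z : ((Fin 5 → ℝ) × ℝ) × ℝ => displacedHeading T Q z.1.1 z.2 :=
      h.comp ((continuous_fst.comp continuous_fst).prodMk continuous_snd)
    simp only [Function.uncurry_def]
    fun_prop
  unfold displacedSpeed
  fun_prop

theorem continuous_displaced (hQ : Continuous Q) :
    Continuous fun p : (Fin 5 → ℝ) × ℝ => displaced A T Q p.1 p.2 := by
  have h := continuous_displacedHeading (T := T) hQ
  have k := continuous_displacedSpeed (A := A) (T := T) hQ
  have h3 : Continuous fun z : ((Fin 5 → ℝ) × ℝ) × ℝ => displacedHeading T Q z.1.1 z.2 :=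
    h.comp ((continuous_fst.comp continuous_fst).prodMk continuous_snd)
  have k3 : Continuous fun z : ((Fin 5 → ℝ) × ℝ) × ℝ => displacedSpeed A T Q z.1.1 z.2 :=
    k.comp ((continuous_fst.comp continuous_fst).prodMk continuous_snd)
  have hc : Continuous fun p : (Fin 5 → ℝ) × ℝ => ∫ s in T..p.2,
      (displacedSpeed A T Q p.1 s * Real.cos (displacedHeading T Q p.1 s) -
        Q s 3 * Real.cos (Q s 2)) := by
    refine intervalIntegral.continuous_parametric_intervalIntegral_of_continuous ?_ continuous_snd
    simp only [Function.uncurry_def]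
    fun_prop
  have hs : Continuous fun p : (Fin 5 → ℝ) × ℝ => ∫ s in T..p.2,
      (displacedSpeed A T Q p.1 s * Real.sin (displacedHeading T Q p.1 s) -
        Q s 3 * Real.sin (Q s 2)) := by
    refine intervalIntegral.continuous_parametric_intervalIntegral_of_continuous ?_ continuous_snd
    simp only [Function.uncurry_def]
    fun_prop
  refine continuous_pi fun i => ?_
  fin_cases i <;> simp [displaced] <;> fun_prop

theorem displaced_zero (t : ℝ) : displaced A T Q 0 t = Q t := by
  ext i
  fin_cases i <;> simp [displaced, displacedSpeed, displacedHeading]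

theorem displaced_end (δ : Fin 5 → ℝ) : displaced A T Q δ T = Q T + δ := by
  ext i
  fin_cases i <;> simp [displaced, displacedSpeed, displacedHeading, ← mul_assoc, ← Real.exp_add]

theorem hasDerivAt_displaced (hQ : Continuous Q) (δ : Fin 5 → ℝ) {t : ℝ} {w : Fin 2 → ℝ}
    (h : HasDerivAt Q (chaplyginSleigh A t (Q t) w) t) :
    HasDerivAt (displaced A T Q δ) (chaplyginSleigh A t (displaced A T Q δ t) w) t := by
  have hH : Continuous (displacedHeading T Q δ) :=
    (continuous_displacedHeading hQ).comp (Continuous.prodMk_right δ)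
  have hS : Continuous (displacedSpeed A T Q δ) :=
    (continuous_displacedSpeed hQ).comp (Continuous.prodMk_right δ)
  have hq := hasDerivAt_pi.1 h
  have dH : HasDerivAt (displacedHeading T Q δ) (Q t 4 + δ 4) t := by
    have := ((hq 2).add_const (δ 2)).add (((hasDerivAt_id t).sub_const T).const_mul (δ 4))
    exact this.congr_deriv (by simp [chaplyginSleigh])
  have dI : ∀ G : ℝ → ℝ, Continuous G → HasDerivAt (fun u => ∫ s in T..u, G s) (G t) t :=
    fun G hG => hG.integral_hasStrictDerivAt T t |>.hasDerivAt
  have dS : HasDerivAt (displacedSpeed A T Q δ)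
      (w 0 + A * displacedSpeed A T Q δ t * (Q t 4 + δ 4)) t := by
    have := (hq 3).add ((dH.const_mul A).exp.mul
      (((dI (fun s => Q s 3 * Real.exp (-(A * displacedHeading T Q δ s)))
        (by fun_prop)).const_mul (A * δ 4)).const_add
        (Real.exp (-(A * displacedHeading T Q δ T)) * δ 3)))
    refine this.congr_deriv ?_
    have e : Real.exp (A * displacedHeading T Q δ t) * Real.exp (-(A * displacedHeading T Q δ t))
      = 1 := by rw [← Real.exp_add]; simp
    simp only [chaplyginSleigh, displacedSpeed, Matrix.cons_val]
    linear_combination (A * δ 4 * Q t 3) * e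
  refine hasDerivAt_pi.2 fun i => ?_
  fin_cases i
  · refine (((hq 0).add_const (δ 0)).add (dI (fun s => displacedSpeed A T Q δ s *
      Real.cos (displacedHeading T Q δ s) - Q s 3 * Real.cos (Q s 2))
      (by fun_prop))).congr_deriv ?_
    simp [chaplyginSleigh, displaced]
  · refine (((hq 1).add_const (δ 1)).add (dI (fun s => displacedSpeed A T Q δ s *
      Real.sin (displacedHeading T Q δ s) - Q s 3 * Real.sin (Q s 2))
      (by fun_prop))).congr_deriv ?_
    simp [chaplyginSleigh, displaced]
  · exact dH
  · exact dS
  · exact ((hq 4).add_const (δ 4)).congr_deriv (by simp [chaplyginSleigh])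

theorem isPiecewiseAnalyticOn_displaced {b : ℝ} (hQ : Continuous Q)
    (h : IsPiecewiseAnalyticOn Q b T) (δ : Fin 5 → ℝ) :
    IsPiecewiseAnalyticOn (displaced A T Q δ) b T := by
  have cH : Continuous (displacedHeading T Q δ) :=
    (continuous_displacedHeading hQ).comp (Continuous.prodMk_right δ)
  have cS : Continuous (displacedSpeed A T Q δ) :=
    (continuous_displacedSpeed hQ).comp (Continuous.prodMk_right δ)
  have hq : ∀ i, IsPiecewiseAnalyticOn (fun t => Q t i) b T := fun i =>
    h.comp_left (φ := fun x : Fin 5 → ℝ => x i) fun x =>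
      (ContinuousLinearMap.proj (R := ℝ) (φ := fun _ : Fin 5 => ℝ) i).analyticAt x
  have han : ∀ g : ℝ → ℝ, (∀ t, AnalyticAt ℝ g t) → IsPiecewiseAnalyticOn g b T := fun g hg =>
    AnalyticOnNhd.isPiecewiseAnalyticOn h.le fun t _ => hg t
  have hH : IsPiecewiseAnalyticOn (displacedHeading T Q δ) b T :=
    ((hq 2).add (han (fun _ => δ 2) (by fun_prop))).add
      (han (fun t => δ 4 * (t - T)) (by fun_prop))
  have hS : IsPiecewiseAnalyticOn (displacedSpeed A T Q δ) b T := by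
    refine (hq 3).add ((hH.comp_left (φ := fun x => Real.exp (A * x)) (by fun_prop)).mul
      ((han (fun _ => _) (by fun_prop)).add ((han (fun _ => A * δ 4) (by fun_prop)).mul
        (IsPiecewiseAnalyticOn.intervalIntegral (by fun_prop) ?_ T))))
    exact (hq 3).mul (hH.comp_left (φ := fun x => Real.exp (-(A * x))) (by fun_prop))
  refine .pi h.le fun i => ?_
  fin_cases i
  · refine ((hq 0).add (han (fun _ => δ 0) (by fun_prop))).add
      (IsPiecewiseAnalyticOn.intervalIntegral (by fun_prop) ?_ T)
    exact (hS.mul (hH.comp_left (φ := Real.cos) (by fun_prop))).sub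
      ((hq 3).mul ((hq 2).comp_left (φ := Real.cos) (by fun_prop)))
  · refine ((hq 1).add (han (fun _ => δ 1) (by fun_prop))).add
      (IsPiecewiseAnalyticOn.intervalIntegral (by fun_prop) ?_ T)
    exact (hS.mul (hH.comp_left (φ := Real.sin) (by fun_prop))).sub
      ((hq 3).mul ((hq 2).comp_left (φ := Real.sin) (by fun_prop)))
  · exact hH
  · exact hS
  · exact (hq 4).add (han (fun _ => δ 4) (by fun_prop))

/-- Every state near the end of a solution is the end of a solution with the same controls which
starts near the initial state. -/
theorem IsControlSolution.eventually_exists_end_eq {K : Set (Fin 2 → ℝ)} {b : ℝ}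
    {q : ℝ → Fin 5 → ℝ} {w : ℝ → Fin 2 → ℝ}
    (h : IsControlSolution (chaplyginSleigh A) K b T q w) (hbT : b ≤ T) {U : Set (Fin 5 → ℝ)}
    (hU : U ∈ 𝓝 (q b)) :
    ∀ᶠ x in 𝓝 (q T), ∃ y ∈ U, x ∈ reachBetween (chaplyginSleigh A) K b T y := by
  set Q : ℝ → Fin 5 → ℝ := IccExtend hbT ((Icc b T).domRestrict q) with hQdef
  have hQ : Continuous Q := (continuousOn_iff_continuous_domRestrict.1 (h.continuousOn hbT)).Icc_extend'
  have hQq : EqOn Q q (Icc b T) := fun t ht => by rw [hQdef, IccExtend_of_mem hbT _ ht]; rfl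
  have hQb : Q b = q b := hQq (left_mem_Icc.2 hbT)
  have hQT : Q T = q T := hQq (right_mem_Icc.2 hbT)
  have hQa : IsPiecewiseAnalyticOn Q b T :=
    h.state_analytic.congr (hQq.mono Ioo_subset_Icc_self)
  have hcont : Continuous fun x => displaced A T Q (x - q T) b :=
    (continuous_displaced hQ).comp ((continuous_id.sub continuous_const).prodMk continuous_const)
  have hU' : U ∈ 𝓝 (displaced A T Q (q T - q T) b) := by
    rwa [sub_self, displaced_zero, hQb]
  filter_upwards [hcont.continuousAt.eventually_mem hU'] with x hx
  refine ⟨_, hx, displaced A T Q (x - q T), w, ?_, rfl, by rw [displaced_end, hQT]; abel⟩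
  refine .of_continuousOn hbT h.control_mem h.control_analytic
    (isPiecewiseAnalyticOn_displaced hQ hQa _)
    ((continuous_displaced hQ).comp (Continuous.prodMk_right _)).continuousOn ?_
  have hb : ∀ᵐ t : ℝ, t ≠ b := by simp [ae_iff]
  have hT : ∀ᵐ t : ℝ, t ≠ T := by simp [ae_iff]
  filter_upwards [h.equation, hb, hT] with t ht hb hT htI
  have hnhds : Icc b T ∈ 𝓝 t := Icc_mem_nhds (htI.1.lt_of_ne' hb) (htI.2.lt_of_ne hT)
  refine hasDerivAt_displaced hQ _ ?_
  rw [hQq htI]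
  exact (ht htI).congr_of_eventuallyEq (by filter_upwards [hnhds] with s hs using hQq hs)

end transport

section flat

/-- The angle close to `θ` of the line spanned by `(X, Y)`. -/
noncomputable def headingNear (θ X Y : ℝ) : ℝ :=
  θ + Real.arctan ((Y * Real.cos θ - X * Real.sin θ) / (X * Real.cos θ + Y * Real.sin θ))

/-- The state of the sleigh at `(x, y)` with heading `Θ`, velocity `(X, Y)` and acceleration
`(X₁, Y₁)`. -/
noncomputable def flatState (x y Θ X Y X₁ Y₁ : ℝ) : Fin 5 → ℝ :=
  ![x, y, Θ, X * Real.cos Θ + Y * Real.sin Θ, (X * Y₁ - Y * X₁) / (X ^ 2 + Y ^ 2)]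

/-- The controls of the sleigh with heading `Θ`, velocity `(X, Y)`, acceleration `(X₁, Y₁)` and
jerk `(X₂, Y₂)`. -/
noncomputable def flatControl (A Θ X Y X₁ Y₁ X₂ Y₂ : ℝ) : Fin 2 → ℝ :=
  ![X₁ * Real.cos Θ + Y₁ * Real.sin Θ -
      A * (X * Real.cos Θ + Y * Real.sin Θ) * ((X * Y₁ - Y * X₁) / (X ^ 2 + Y ^ 2)),
    ((X * Y₂ - Y * X₂) * (X ^ 2 + Y ^ 2) - (X * Y₁ - Y * X₁) * (2 * X * X₁ + 2 * Y * Y₁)) /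
      (X ^ 2 + Y ^ 2) ^ 2]

theorem cos_headingNear {θ X Y : ℝ} (h : X * Real.cos θ + Y * Real.sin θ ≠ 0) :
    Y * Real.cos (headingNear θ X Y) = X * Real.sin (headingNear θ X Y) := by
  rw [headingNear, Real.cos_add, Real.sin_add, Real.sin_arctan, Real.cos_arctan]
  set D := X * Real.cos θ + Y * Real.sin θ with hD
  have hs : (0 : ℝ) < √(1 + ((Y * Real.cos θ - X * Real.sin θ) / D) ^ 2) := by positivity
  field_simp
  rw [hD]
  ring

theorem sq_add_sq_ne_zero {θ X Y : ℝ} (h : X * Real.cos θ + Y * Real.sin θ ≠ 0) :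
    X ^ 2 + Y ^ 2 ≠ 0 := by
  intro h0
  have hX : X = 0 := by nlinarith [sq_nonneg X, sq_nonneg Y]
  have hY : Y = 0 := by nlinarith [sq_nonneg X, sq_nonneg Y]
  simp [hX, hY] at h

theorem headingNear_polar {θ φ v : ℝ} (hv : v ≠ 0) (h₁ : -(Real.pi / 2) < φ - θ)
    (h₂ : φ - θ < Real.pi / 2) : headingNear θ (v * Real.cos φ) (v * Real.sin φ) = φ := by
  have hc : 0 < Real.cos (φ - θ) := Real.cos_pos_of_mem_Ioo ⟨h₁, h₂⟩
  have e : (v * Real.sin φ * Real.cos θ - v * Real.cos φ * Real.sin θ) /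
      (v * Real.cos φ * Real.cos θ + v * Real.sin φ * Real.sin θ) = Real.tan (φ - θ) := by
    rw [Real.tan_eq_sin_div_cos, Real.sin_sub, Real.cos_sub]
    rw [Real.cos_sub] at hc
    rw [div_eq_div_iff (fun h => hc.ne' (mul_left_cancel₀ hv (by linarith))) hc.ne']
    ring
  rw [headingNear, e, Real.arctan_tan h₁ h₂]
  ring

theorem flatState_polar {x y Θ v ω v₁ : ℝ} (hv : v ≠ 0) :
    flatState x y Θ (v * Real.cos Θ) (v * Real.sin Θ) (v₁ * Real.cos Θ - v * ω * Real.sin Θ)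
      (v₁ * Real.sin Θ + v * ω * Real.cos Θ) = ![x, y, Θ, v, ω] := by
  have h := Real.cos_sq_add_sin_sq Θ
  have e1 : v * Real.cos Θ * Real.cos Θ + v * Real.sin Θ * Real.sin Θ = v := by
    linear_combination v * h
  have e2 : (v * Real.cos Θ) ^ 2 + (v * Real.sin Θ) ^ 2 = v ^ 2 := by
    linear_combination v ^ 2 * h
  have e3 : v * Real.cos Θ * (v₁ * Real.sin Θ + v * ω * Real.cos Θ) -
      v * Real.sin Θ * (v₁ * Real.cos Θ - v * ω * Real.sin Θ) = v ^ 2 * ω := by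
    linear_combination v ^ 2 * ω * h
  rw [flatState, e1, e2, e3, mul_div_cancel_left₀ _ (pow_ne_zero 2 hv)]

theorem flatControl_polar {A Θ v ω v₁ v₂ ω₁ : ℝ} (hv : v ≠ 0) :
    flatControl A Θ (v * Real.cos Θ) (v * Real.sin Θ) (v₁ * Real.cos Θ - v * ω * Real.sin Θ)
      (v₁ * Real.sin Θ + v * ω * Real.cos Θ)
      (v₂ * Real.cos Θ - 2 * v₁ * ω * Real.sin Θ - v * ω₁ * Real.sin Θ -
        v * ω ^ 2 * Real.cos Θ)
      (v₂ * Real.sin Θ + 2 * v₁ * ω * Real.cos Θ + v * ω₁ * Real.cos Θ -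
        v * ω ^ 2 * Real.sin Θ) = ![v₁ - A * v * ω, ω₁] := by
  have h := Real.cos_sq_add_sin_sq Θ
  have e1 : v * Real.cos Θ * Real.cos Θ + v * Real.sin Θ * Real.sin Θ = v := by
    linear_combination v * h
  have e2 : (v * Real.cos Θ) ^ 2 + (v * Real.sin Θ) ^ 2 = v ^ 2 := by
    linear_combination v ^ 2 * h
  have e3 : v * Real.cos Θ * (v₁ * Real.sin Θ + v * ω * Real.cos Θ) -
      v * Real.sin Θ * (v₁ * Real.cos Θ - v * ω * Real.sin Θ) = v ^ 2 * ω := by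
    linear_combination v ^ 2 * ω * h
  have e4 : (v₁ * Real.cos Θ - v * ω * Real.sin Θ) * Real.cos Θ +
      (v₁ * Real.sin Θ + v * ω * Real.cos Θ) * Real.sin Θ = v₁ := by
    linear_combination v₁ * h
  have e5 : v * Real.cos Θ * (v₂ * Real.sin Θ + 2 * v₁ * ω * Real.cos Θ + v * ω₁ * Real.cos Θ -
        v * ω ^ 2 * Real.sin Θ) - v * Real.sin Θ * (v₂ * Real.cos Θ - 2 * v₁ * ω * Real.sin Θ -
        v * ω₁ * Real.sin Θ - v * ω ^ 2 * Real.cos Θ) = v * (2 * v₁ * ω + v * ω₁) := by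
    linear_combination v * (2 * v₁ * ω + v * ω₁) * h
  have e6 : 2 * (v * Real.cos Θ) * (v₁ * Real.cos Θ - v * ω * Real.sin Θ) +
      2 * (v * Real.sin Θ) * (v₁ * Real.sin Θ + v * ω * Real.cos Θ) = 2 * v * v₁ := by
    linear_combination 2 * v * v₁ * h
  rw [flatControl, e1, e2, e3, e4, e5, e6, mul_div_cancel_left₀ _ (pow_ne_zero 2 hv)]
  congr 2
  field_simp
  ring

theorem hasDerivAt_flatState {A t : ℝ} {x y θ X Y X₁ Y₁ : ℝ → ℝ} {θ₁ X₂ Y₂ : ℝ}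
    (hx : HasDerivAt x (X t) t) (hy : HasDerivAt y (Y t) t) (hθ : HasDerivAt θ θ₁ t)
    (hX : HasDerivAt X (X₁ t) t) (hY : HasDerivAt Y (Y₁ t) t) (hX₁ : HasDerivAt X₁ X₂ t)
    (hY₁ : HasDerivAt Y₁ Y₂ t) (hD : X t * Real.cos (θ t) + Y t * Real.sin (θ t) ≠ 0) :
    HasDerivAt (fun s => flatState (x s) (y s) (headingNear (θ s) (X s) (Y s)) (X s) (Y s) (X₁ s)
        (Y₁ s))
      (chaplyginSleigh A t
        (flatState (x t) (y t) (headingNear (θ t) (X t) (Y t)) (X t) (Y t) (X₁ t) (Y₁ t))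
        (flatControl A (headingNear (θ t) (X t) (Y t)) (X t) (Y t) (X₁ t) (Y₁ t) X₂ Y₂)) t := by
  have hN : X t ^ 2 + Y t ^ 2 ≠ 0 := sq_add_sq_ne_zero hD
  have hperp := cos_headingNear hD
  have dΘ : HasDerivAt (fun s => headingNear (θ s) (X s) (Y s))
      ((X t * Y₁ t - Y t * X₁ t) / (X t ^ 2 + Y t ^ 2)) t := by
    have := hθ.add ((((hY.mul hθ.cos).sub (hX.mul hθ.sin)).div
      ((hX.mul hθ.cos).add (hY.mul hθ.sin)) hD).arctan)
    refine this.congr_deriv ?_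
    simp only [Pi.mul_apply, Pi.add_apply, Pi.sub_apply, Pi.div_apply]
    have hcs := Real.cos_sq_add_sin_sq (θ t)
    set c := Real.cos (θ t)
    set s := Real.sin (θ t)
    have hsum : (X t * c + Y t * s) ^ 2 + (Y t * c - X t * s) ^ 2 = X t ^ 2 + Y t ^ 2 := by
      linear_combination (X t ^ 2 + Y t ^ 2) * hcs
    have e : 1 / (1 + ((Y t * c - X t * s) / (X t * c + Y t * s)) ^ 2) =
        (X t * c + Y t * s) ^ 2 / (X t ^ 2 + Y t ^ 2) := by
      rw [← hsum]
      rw [← hsum] at hN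
      rw [div_pow, one_add_div (pow_ne_zero 2 hD), one_div_div]
    rw [e]
    field_simp
    linear_combination (X t * Y₁ t - Y t * X₁ t - θ₁ * (X t ^ 2 + Y t ^ 2)) * hcs
  refine hasDerivAt_pi.2 fun i => ?_
  set Θ := headingNear (θ t) (X t) (Y t)
  have hcs := Real.cos_sq_add_sin_sq Θ
  fin_cases i
  · refine hx.congr_deriv ?_
    simp only [chaplyginSleigh, flatState, Matrix.cons_val, Fin.zero_eta]
    linear_combination -X t * hcs - Real.sin Θ * hperp
  · refine hy.congr_deriv ?_
    simp only [chaplyginSleigh, flatState, Matrix.cons_val, Fin.mk_one]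
    linear_combination -Y t * hcs + Real.cos Θ * hperp
  · exact dΘ
  · refine ((hX.mul dΘ.cos).add (hY.mul dΘ.sin)).congr_deriv ?_
    simp only [chaplyginSleigh, flatState, flatControl, Matrix.cons_val, Fin.reduceFinMk]
    linear_combination ((X t * Y₁ t - Y t * X₁ t) / (X t ^ 2 + Y t ^ 2)) * hperp
  · refine (((hX.mul hY₁).sub (hY.mul hX₁)).div ((hX.pow 2).add (hY.pow 2)) hN).congr_deriv ?_
    simp only [chaplyginSleigh, flatControl, Matrix.cons_val, Fin.reduceFinMk, Pi.mul_apply,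
      Pi.add_apply, Pi.sub_apply, Pi.pow_apply]
    congr 1
    push_cast
    ring

/-- The polynomial in `t`, flat to second order at `a`, with the 2-jet `(e₀, e₁, e₂)` at `b`. -/
noncomputable def flatInterp (a b e₀ e₁ e₂ : ℝ) (j : Fin 4) (t : ℝ) : ℝ :=
  let L := b - a
  let α := e₀ / L ^ 3
  let β := (e₁ - 3 * L ^ 2 * α) / L ^ 3
  let γ := (e₂ - 6 * L * α - 6 * L ^ 2 * β) / (2 * L ^ 3)
  let M := α + β * (t - b) + γ * (t - b) ^ 2
  let M₁ := β + 2 * γ * (t - b)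
  ![(t - a) ^ 3 * M, 3 * (t - a) ^ 2 * M + (t - a) ^ 3 * M₁,
    6 * (t - a) * M + 6 * (t - a) ^ 2 * M₁ + (t - a) ^ 3 * (2 * γ),
    6 * M + 18 * (t - a) * M₁ + 18 * (t - a) ^ 2 * γ] j

section interp

variable {a b : ℝ} (e₀ e₁ e₂ : ℝ)

theorem flatInterp_left (j : Fin 4) (hj : j ≠ 3) : flatInterp a b e₀ e₁ e₂ j a = 0 := by
  fin_cases j <;> simp [flatInterp] at hj ⊢

theorem flatInterp_right (hab : a ≠ b) : flatInterp a b e₀ e₁ e₂ 0 b = e₀ ∧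
    flatInterp a b e₀ e₁ e₂ 1 b = e₁ ∧ flatInterp a b e₀ e₁ e₂ 2 b = e₂ := by
  have hL : b - a ≠ 0 := sub_ne_zero.2 hab.symm
  refine ⟨?_, ?_, ?_⟩ <;> simp [flatInterp] <;> field_simp <;> ring

theorem flatInterp_zero (j : Fin 4) (t : ℝ) : flatInterp a b 0 0 0 j t = 0 := by
  fin_cases j <;> simp [flatInterp]

theorem hasDerivAt_flatInterp_zero (t : ℝ) :
    HasDerivAt (flatInterp a b e₀ e₁ e₂ 0) (flatInterp a b e₀ e₁ e₂ 1 t) t := by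
  have ha := (hasDerivAt_id t).sub_const a
  have hb := (hasDerivAt_id t).sub_const b
  set L := b - a with hL
  set α := e₀ / L ^ 3 with hα
  set β := (e₁ - 3 * L ^ 2 * α) / L ^ 3 with hβ
  set γ := (e₂ - 6 * L * α - 6 * L ^ 2 * β) / (2 * L ^ 3) with hγ
  have := (ha.pow 3).mul (((hb.const_mul β).const_add α).add ((hb.pow 2).const_mul γ))
  refine (this.congr_deriv ?_)
  simp [flatInterp, ← hL, ← hα, ← hβ, ← hγ]
  exact .inl (by ring)

theorem hasDerivAt_flatInterp_one (t : ℝ) :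
    HasDerivAt (flatInterp a b e₀ e₁ e₂ 1) (flatInterp a b e₀ e₁ e₂ 2 t) t := by
  have ha := (hasDerivAt_id t).sub_const a
  have hb := (hasDerivAt_id t).sub_const b
  set L := b - a with hL
  set α := e₀ / L ^ 3 with hα
  set β := (e₁ - 3 * L ^ 2 * α) / L ^ 3 with hβ
  set γ := (e₂ - 6 * L * α - 6 * L ^ 2 * β) / (2 * L ^ 3) with hγ
  have hM := ((hb.const_mul β).const_add α).add ((hb.pow 2).const_mul γ)
  have hM₁ := (hb.const_mul (2 * γ)).const_add β
  refine ((((ha.pow 2).const_mul 3).mul hM).add ((ha.pow 3).mul hM₁)).congr_deriv ?_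
  simp [flatInterp, ← hL, ← hα, ← hβ, ← hγ]
  ring

theorem hasDerivAt_flatInterp_two (t : ℝ) :
    HasDerivAt (flatInterp a b e₀ e₁ e₂ 2) (flatInterp a b e₀ e₁ e₂ 3 t) t := by
  have ha := (hasDerivAt_id t).sub_const a
  have hb := (hasDerivAt_id t).sub_const b
  set L := b - a with hL
  set α := e₀ / L ^ 3 with hα
  set β := (e₁ - 3 * L ^ 2 * α) / L ^ 3 with hβ
  set γ := (e₂ - 6 * L * α - 6 * L ^ 2 * β) / (2 * L ^ 3) with hγ
  have hM := ((hb.const_mul β).const_add α).add ((hb.pow 2).const_mul γ)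
  have hM₁ := (hb.const_mul (2 * γ)).const_add β
  refine ((((ha.const_mul 6).mul hM).add (((ha.pow 2).const_mul 6).mul hM₁)).add
    ((ha.pow 3).mul_const (2 * γ))).congr_deriv ?_
  simp [flatInterp, ← hL, ← hα, ← hβ, ← hγ]
  ring

theorem analyticAt_flatInterp (j : Fin 4) (t : ℝ) :
    AnalyticAt ℝ (flatInterp a b e₀ e₁ e₂ j) t := by
  unfold flatInterp
  fin_cases j <;> simp only [Matrix.cons_val, Fin.reduceFinMk, Fin.zero_eta, Fin.mk_one] <;>
    fun_prop

theorem continuous_flatInterp {Z : Type*} [TopologicalSpace Z] {g₀ g₁ g₂ s : Z → ℝ}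
    (h₀ : Continuous g₀) (h₁ : Continuous g₁) (h₂ : Continuous g₂) (hs : Continuous s)
    (j : Fin 4) : Continuous fun z => flatInterp a b (g₀ z) (g₁ z) (g₂ z) j (s z) := by
  unfold flatInterp
  simp only [div_eq_mul_inv]
  fin_cases j <;> simp only [Matrix.cons_val, Fin.reduceFinMk, Fin.zero_eta, Fin.mk_one] <;>
    fun_prop

end interp

end flat

theorem IsControlSolution.of_analyticOnNhd {n m : ℕ}
    {f : ℝ → (Fin n → ℝ) → (Fin m → ℝ) → (Fin n → ℝ)} {K : Set (Fin m → ℝ)} {a b : ℝ}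
    {q : ℝ → (Fin n → ℝ)} {w : ℝ → (Fin m → ℝ)} (hab : a ≤ b)
    (hwK : ∀ t ∈ Icc a b, w t ∈ K) (hw : AnalyticOnNhd ℝ w (Icc a b))
    (hq : AnalyticOnNhd ℝ q (Icc a b))
    (he : ∀ t ∈ Icc a b, HasDerivAt q (f t (q t) (w t)) t) : IsControlSolution f K a b q w :=
  .of_continuousOn hab hwK (hw.isPiecewiseAnalyticOn hab) (hq.isPiecewiseAnalyticOn hab)
    hq.continuousOn (Filter.Eventually.of_forall he)

section flatAnalytic

variable {A t : ℝ} {x y θ X Y X₁ Y₁ X₂ Y₂ : ℝ → ℝ}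

theorem AnalyticAt.headingNear (hθ : AnalyticAt ℝ θ t) (hX : AnalyticAt ℝ X t)
    (hY : AnalyticAt ℝ Y t) (hD : X t * Real.cos (θ t) + Y t * Real.sin (θ t) ≠ 0) :
    AnalyticAt ℝ (fun s => headingNear (θ s) (X s) (Y s)) t := by
  have harctan : ∀ r, AnalyticAt ℝ Real.arctan r := fun r =>
    Real.contDiff_arctan.contDiffAt.analyticAt
  have hc : AnalyticAt ℝ (fun s => Real.cos (θ s)) t := Real.analyticAt_cos.fun_comp hθ
  have hs : AnalyticAt ℝ (fun s => Real.sin (θ s)) t := Real.analyticAt_sin.fun_comp hθ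
  exact hθ.add ((harctan _).fun_comp (((hY.mul hc).sub (hX.mul hs)).div
    ((hX.mul hc).add (hY.mul hs)) hD))

theorem AnalyticAt.flatState (hx : AnalyticAt ℝ x t) (hy : AnalyticAt ℝ y t)
    (hθ : AnalyticAt ℝ θ t) (hX : AnalyticAt ℝ X t) (hY : AnalyticAt ℝ Y t)
    (hX₁ : AnalyticAt ℝ X₁ t) (hY₁ : AnalyticAt ℝ Y₁ t) (hN : X t ^ 2 + Y t ^ 2 ≠ 0) :
    AnalyticAt ℝ (fun s => flatState (x s) (y s) (θ s) (X s) (Y s) (X₁ s) (Y₁ s)) t := by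
  have hc : AnalyticAt ℝ (fun s => Real.cos (θ s)) t := Real.analyticAt_cos.fun_comp hθ
  have hs : AnalyticAt ℝ (fun s => Real.sin (θ s)) t := Real.analyticAt_sin.fun_comp hθ
  refine AnalyticAt.pi fun i => ?_
  fin_cases i
  · exact hx
  · exact hy
  · exact hθ
  · exact (hX.mul hc).add (hY.mul hs)
  · exact ((hX.mul hY₁).sub (hY.mul hX₁)).div ((hX.pow 2).add (hY.pow 2)) hN

theorem AnalyticAt.flatControl (hθ : AnalyticAt ℝ θ t) (hX : AnalyticAt ℝ X t)
    (hY : AnalyticAt ℝ Y t) (hX₁ : AnalyticAt ℝ X₁ t) (hY₁ : AnalyticAt ℝ Y₁ t)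
    (hX₂ : AnalyticAt ℝ X₂ t) (hY₂ : AnalyticAt ℝ Y₂ t) (hN : X t ^ 2 + Y t ^ 2 ≠ 0) :
    AnalyticAt ℝ
      (fun s => flatControl A (θ s) (X s) (Y s) (X₁ s) (Y₁ s) (X₂ s) (Y₂ s)) t := by
  have hc : AnalyticAt ℝ (fun s => Real.cos (θ s)) t := Real.analyticAt_cos.fun_comp hθ
  have hs : AnalyticAt ℝ (fun s => Real.sin (θ s)) t := Real.analyticAt_sin.fun_comp hθ
  have hn := (hX.pow 2).add (hY.pow 2)
  have hp := (hX.mul hY₁).sub (hY.mul hX₁)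
  refine AnalyticAt.pi fun i => ?_
  fin_cases i
  · exact ((hX₁.mul hc).add (hY₁.mul hs)).sub
      (((analyticAt_const (v := A)).mul ((hX.mul hc).add (hY.mul hs))).mul (hp.div hn hN))
  · exact ((((hX.mul hY₂).sub (hY.mul hX₂)).mul hn).sub
      (hp.mul ((((analyticAt_const (v := (2 : ℝ))).mul hX).mul hX₁).add
        (((analyticAt_const (v := (2 : ℝ))).mul hY).mul hY₁)))).div (hn.pow 2) (pow_ne_zero 2 hN)

end flatAnalytic

section flatContinuous

variable {Z : Type*} [TopologicalSpace Z] {z : Z} {A : ℝ} {θ X Y X₁ Y₁ X₂ Y₂ : Z → ℝ}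

theorem ContinuousAt.headingNear (hθ : ContinuousAt θ z) (hX : ContinuousAt X z)
    (hY : ContinuousAt Y z) (hD : X z * Real.cos (θ z) + Y z * Real.sin (θ z) ≠ 0) :
    ContinuousAt (fun s => headingNear (θ s) (X s) (Y s)) z := by
  have hc := Real.continuous_cos.continuousAt.comp' hθ
  have hs := Real.continuous_sin.continuousAt.comp' hθ
  exact hθ.add (Real.continuous_arctan.continuousAt.comp' (((hY.mul hc).sub (hX.mul hs)).div
    ((hX.mul hc).add (hY.mul hs)) hD))

theorem ContinuousAt.flatControl (hθ : ContinuousAt θ z) (hX : ContinuousAt X z)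
    (hY : ContinuousAt Y z) (hX₁ : ContinuousAt X₁ z) (hY₁ : ContinuousAt Y₁ z)
    (hX₂ : ContinuousAt X₂ z) (hY₂ : ContinuousAt Y₂ z) (hN : X z ^ 2 + Y z ^ 2 ≠ 0) :
    ContinuousAt
      (fun s => flatControl A (θ s) (X s) (Y s) (X₁ s) (Y₁ s) (X₂ s) (Y₂ s)) z := by
  have hc := Real.continuous_cos.continuousAt.comp' hθ
  have hs := Real.continuous_sin.continuousAt.comp' hθ
  have hn := (hX.pow 2).add (hY.pow 2)
  have hp := (hX.mul hY₁).sub (hY.mul hX₁)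
  refine continuousAt_pi.2 fun i => ?_
  fin_cases i
  · exact ((hX₁.mul hc).add (hY₁.mul hs)).sub
      ((continuousAt_const.mul ((hX.mul hc).add (hY.mul hs))).mul (hp.div hn hN))
  · exact ((((hX.mul hY₂).sub (hY.mul hX₂)).mul hn).sub
      (hp.mul (((continuousAt_const.mul hX).mul hX₁).add
        ((continuousAt_const.mul hY).mul hY₁)))).div (hn.pow 2) (pow_ne_zero 2 hN)

end flatContinuous

section localOpenness

variable {A : ℝ} {K : Set (Fin 2 → ℝ)} {a b : ℝ} {q : ℝ → (Fin 5 → ℝ)} {w : ℝ → (Fin 2 → ℝ)}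

/-- Around an analytic solution along which the speed does not vanish all states near the end
are reached. -/
theorem eventually_mem_reachBetween_of_speed_ne_zero (hK : IsOpen K) (hab : a < b)
    (hq : AnalyticOnNhd ℝ q (Icc a b)) (hw : AnalyticOnNhd ℝ w (Icc a b))
    (hd : ∀ t ∈ Icc a b, HasDerivAt q (chaplyginSleigh A t (q t) (w t)) t)
    (hwK : ∀ t ∈ Icc a b, w t ∈ K) (hv : ∀ t ∈ Icc a b, q t 3 ≠ 0) :
    ∀ᶠ x in 𝓝 (q b), x ∈ reachBetween (chaplyginSleigh A) K a b (q a) := by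
  have haI : a ∈ Icc a b := left_mem_Icc.2 hab.le
  have hbI : b ∈ Icc a b := right_mem_Icc.2 hab.le
  have hpi : 0 < Real.pi / 2 := by positivity
  have aq : ∀ t ∈ Icc a b, ∀ i, AnalyticAt ℝ (fun s => q s i) t := fun t ht i =>
    analyticAt_pi_iff.1 (hq t ht) i
  have aw : ∀ t ∈ Icc a b, ∀ i, AnalyticAt ℝ (fun s => w s i) t := fun t ht i =>
    analyticAt_pi_iff.1 (hw t ht) i
  have dq : ∀ t ∈ Icc a b, ∀ i, HasDerivAt (fun s => q s i)
      (chaplyginSleigh A t (q t) (w t) i) t := fun t ht i => hasDerivAt_pi.1 (hd t ht) i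
  set v₁ : ℝ → ℝ := fun t => w t 0 + A * q t 3 * q t 4 with hv₁
  have av₁ : ∀ t ∈ Icc a b, AnalyticAt ℝ v₁ t := fun t ht =>
    (aw t ht 0).add ((analyticAt_const.mul (aq t ht 3)).mul (aq t ht 4))
  set v₂ : ℝ → ℝ := deriv v₁ with hv₂
  have av₂ : ∀ t ∈ Icc a b, AnalyticAt ℝ v₂ t := fun t ht => (av₁ t ht).deriv
  have dv₁ : ∀ t ∈ Icc a b, HasDerivAt v₁ (v₂ t) t := fun t ht =>
    (av₁ t ht).differentiableAt.hasDerivAt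
  have ac : ∀ t ∈ Icc a b, AnalyticAt ℝ (fun s => Real.cos (q s 2)) t := fun t ht =>
    Real.analyticAt_cos.fun_comp (aq t ht 2)
  have as : ∀ t ∈ Icc a b, AnalyticAt ℝ (fun s => Real.sin (q s 2)) t := fun t ht =>
    Real.analyticAt_sin.fun_comp (aq t ht 2)
  set PX : Fin 4 → (Fin 5 → ℝ) → ℝ → ℝ := fun j x t => flatInterp a b (x 0 - q b 0)
    (x 3 * Real.cos (x 2) - q b 3 * Real.cos (q b 2))
    ((v₁ b * Real.cos (x 2) - x 3 * x 4 * Real.sin (x 2)) -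
      (v₁ b * Real.cos (q b 2) - q b 3 * q b 4 * Real.sin (q b 2))) j t with hPX
  set PY : Fin 4 → (Fin 5 → ℝ) → ℝ → ℝ := fun j x t => flatInterp a b (x 1 - q b 1)
    (x 3 * Real.sin (x 2) - q b 3 * Real.sin (q b 2))
    ((v₁ b * Real.sin (x 2) + x 3 * x 4 * Real.cos (x 2)) -
      (v₁ b * Real.sin (q b 2) + q b 3 * q b 4 * Real.cos (q b 2))) j t with hPY
  have cPX : ∀ j, Continuous fun z : (Fin 5 → ℝ) × ℝ => PX j z.1 z.2 := fun j =>
    continuous_flatInterp (by fun_prop) (by fun_prop) (by fun_prop) continuous_snd j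
  have cPY : ∀ j, Continuous fun z : (Fin 5 → ℝ) × ℝ => PY j z.1 z.2 := fun j =>
    continuous_flatInterp (by fun_prop) (by fun_prop) (by fun_prop) continuous_snd j
  have PX0 : ∀ j t, PX j (q b) t = 0 := fun j t => by simp [hPX, flatInterp_zero]
  have PY0 : ∀ j t, PY j (q b) t = 0 := fun j t => by simp [hPY, flatInterp_zero]
  set RX : ℝ → ℝ := fun t => q t 3 * Real.cos (q t 2) with hRX
  set RY : ℝ → ℝ := fun t => q t 3 * Real.sin (q t 2) with hRY
  set RX₁ : ℝ → ℝ := fun t => v₁ t * Real.cos (q t 2) - q t 3 * q t 4 * Real.sin (q t 2) with hRX₁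
  set RY₁ : ℝ → ℝ := fun t => v₁ t * Real.sin (q t 2) + q t 3 * q t 4 * Real.cos (q t 2) with hRY₁
  set RX₂ : ℝ → ℝ := fun t => v₂ t * Real.cos (q t 2) - 2 * v₁ t * q t 4 * Real.sin (q t 2) -
    q t 3 * w t 1 * Real.sin (q t 2) - q t 3 * q t 4 ^ 2 * Real.cos (q t 2) with hRX₂
  set RY₂ : ℝ → ℝ := fun t => v₂ t * Real.sin (q t 2) + 2 * v₁ t * q t 4 * Real.cos (q t 2) +
    q t 3 * w t 1 * Real.cos (q t 2) - q t 3 * q t 4 ^ 2 * Real.sin (q t 2) with hRY₂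
  have aRX : ∀ t ∈ Icc a b, AnalyticAt ℝ RX t := fun t ht => (aq t ht 3).mul (ac t ht)
  have aRY : ∀ t ∈ Icc a b, AnalyticAt ℝ RY t := fun t ht => (aq t ht 3).mul (as t ht)
  have aRX₁ : ∀ t ∈ Icc a b, AnalyticAt ℝ RX₁ t := fun t ht =>
    ((av₁ t ht).mul (ac t ht)).sub (((aq t ht 3).mul (aq t ht 4)).mul (as t ht))
  have aRY₁ : ∀ t ∈ Icc a b, AnalyticAt ℝ RY₁ t := fun t ht =>
    ((av₁ t ht).mul (as t ht)).add (((aq t ht 3).mul (aq t ht 4)).mul (ac t ht))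
  have aRX₂ : ∀ t ∈ Icc a b, AnalyticAt ℝ RX₂ t := fun t ht =>
    ((((av₂ t ht).mul (ac t ht)).sub (((analyticAt_const.mul (av₁ t ht)).mul (aq t ht 4)).mul
      (as t ht))).sub (((aq t ht 3).mul (aw t ht 1)).mul (as t ht))).sub
      (((aq t ht 3).mul ((aq t ht 4).pow 2)).mul (ac t ht))
  have aRY₂ : ∀ t ∈ Icc a b, AnalyticAt ℝ RY₂ t := fun t ht =>
    ((((av₂ t ht).mul (as t ht)).add (((analyticAt_const.mul (av₁ t ht)).mul (aq t ht 4)).mul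
      (ac t ht))).add (((aq t ht 3).mul (aw t ht 1)).mul (ac t ht))).sub
      (((aq t ht 3).mul ((aq t ht 4).pow 2)).mul (as t ht))
  have dRX : ∀ t ∈ Icc a b, HasDerivAt RX (RX₁ t) t := fun t ht =>
    ((dq t ht 3).mul (dq t ht 2).cos).congr_deriv (by
      simp only [hRX₁, hv₁, chaplyginSleigh, Matrix.cons_val]; ring)
  have dRY : ∀ t ∈ Icc a b, HasDerivAt RY (RY₁ t) t := fun t ht =>
    ((dq t ht 3).mul (dq t ht 2).sin).congr_deriv (by
      simp only [hRY₁, hv₁, chaplyginSleigh, Matrix.cons_val]; ring)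
  have dRX₁ : ∀ t ∈ Icc a b, HasDerivAt RX₁ (RX₂ t) t := fun t ht =>
    (((dv₁ t ht).mul (dq t ht 2).cos).sub
      (((dq t ht 3).mul (dq t ht 4)).mul (dq t ht 2).sin)).congr_deriv (by
        simp only [hRX₂, hv₁, chaplyginSleigh, Matrix.cons_val, Pi.mul_apply]; ring)
  have dRY₁ : ∀ t ∈ Icc a b, HasDerivAt RY₁ (RY₂ t) t := fun t ht =>
    (((dv₁ t ht).mul (dq t ht 2).sin).add
      (((dq t ht 3).mul (dq t ht 4)).mul (dq t ht 2).cos)).congr_deriv (by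
        simp only [hRY₂, hv₁, chaplyginSleigh, Matrix.cons_val, Pi.mul_apply]; ring)
  set Θ : (Fin 5 → ℝ) → ℝ → ℝ := fun x t =>
    headingNear (q t 2) (RX t + PX 1 x t) (RY t + PY 1 x t) with hΘ
  set W : (Fin 5 → ℝ) → ℝ → Fin 2 → ℝ := fun x t =>
    flatControl A (Θ x t) (RX t + PX 1 x t) (RY t + PY 1 x t) (RX₁ t + PX 2 x t)
      (RY₁ t + PY 2 x t) (RX₂ t + PX 3 x t) (RY₂ t + PY 3 x t) with hW
  set S : (Fin 5 → ℝ) → ℝ → Fin 5 → ℝ := fun x t =>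
    flatState (q t 0 + PX 0 x t) (q t 1 + PY 0 x t) (Θ x t) (RX t + PX 1 x t) (RY t + PY 1 x t)
      (RX₁ t + PX 2 x t) (RY₁ t + PY 2 x t) with hS
  have hheading : ∀ t ∈ Icc a b, headingNear (q t 2) (RX t) (RY t) = q t 2 := fun t ht =>
    headingNear_polar (hv t ht) (by simpa using hpi) (by simpa using hpi)
  have href : ∀ t ∈ Icc a b, RX t * Real.cos (q t 2) + RY t * Real.sin (q t 2) ≠ 0 := by
    intro t ht
    have : RX t * Real.cos (q t 2) + RY t * Real.sin (q t 2) = q t 3 := by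
      linear_combination q t 3 * Real.cos_sq_add_sin_sq (q t 2)
    rw [this]
    exact hv t ht
  have htube : ∀ᶠ x in 𝓝 (q b), ∀ t ∈ Icc a b,
      (RX t + PX 1 x t) * Real.cos (q t 2) + (RY t + PY 1 x t) * Real.sin (q t 2) ≠ 0 ∧
        W x t ∈ K := by
    refine isCompact_Icc.eventually_forall_of_forall_eventually fun t ht => ?_
    have lift : ∀ {g : ℝ → ℝ}, AnalyticAt ℝ g t →
        ContinuousAt (fun z : (Fin 5 → ℝ) × ℝ => g z.2) (q b, t) := fun hg =>
      ContinuousAt.comp' (x := (q b, t)) (f := Prod.snd) hg.continuousAt continuousAt_snd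
    have kθ := lift (aq t ht 2)
    have kX := (lift (aRX t ht)).add (cPX 1).continuousAt
    have kY := (lift (aRY t ht)).add (cPY 1).continuousAt
    have kX₁ := (lift (aRX₁ t ht)).add (cPX 2).continuousAt
    have kY₁ := (lift (aRY₁ t ht)).add (cPY 2).continuousAt
    have kX₂ := (lift (aRX₂ t ht)).add (cPX 3).continuousAt
    have kY₂ := (lift (aRY₂ t ht)).add (cPY 3).continuousAt
    have hD : (RX t + PX 1 (q b) t) * Real.cos (q t 2) +
        (RY t + PY 1 (q b) t) * Real.sin (q t 2) ≠ 0 := by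
      rw [PX0, PY0, add_zero, add_zero]
      exact href t ht
    have kΘ : ContinuousAt (fun z : (Fin 5 → ℝ) × ℝ => Θ z.1 z.2) (q b, t) :=
      kθ.headingNear kX kY hD
    have kW : ContinuousAt (fun z : (Fin 5 → ℝ) × ℝ => W z.1 z.2) (q b, t) :=
      kΘ.flatControl kX kY kX₁ kY₁ kX₂ kY₂ (sq_add_sq_ne_zero hD)
    have hWK : W (q b) t ∈ K := by
      have : W (q b) t = w t := by
        simp only [hW, hΘ, PX0, PY0, add_zero, hheading t ht]
        rw [flatControl_polar (hv t ht)]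
        ext i
        fin_cases i <;> simp [hv₁]
      rw [this]
      exact hwK t ht
    have kc := Real.continuous_cos.continuousAt.comp' kθ
    have ks := Real.continuous_sin.continuousAt.comp' kθ
    exact (((kX.mul kc).add (kY.mul ks)).eventually_ne hD).and
      (kW.eventually_mem (hK.mem_nhds hWK))
  have hx3 : ∀ᶠ x in 𝓝 (q b), x 3 ≠ 0 :=
    (continuous_apply 3).continuousAt.eventually_ne (hv b hbI)
  have hx2 : ∀ᶠ x in 𝓝 (q b), x 2 - q b 2 ∈ Ioo (-(Real.pi / 2)) (Real.pi / 2) := by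
    have : ContinuousAt (fun x : Fin 5 → ℝ => x 2 - q b 2) (q b) :=
      ((continuous_apply 2).sub continuous_const).continuousAt
    exact this.eventually_mem (Ioo_mem_nhds (by simpa using hpi) (by simpa using hpi))
  have aPX : ∀ x j t, AnalyticAt ℝ (PX j x) t := fun x j t => analyticAt_flatInterp _ _ _ j t
  have aPY : ∀ x j t, AnalyticAt ℝ (PY j x) t := fun x j t => analyticAt_flatInterp _ _ _ j t
  filter_upwards [htube, hx3, hx2] with x hx hx3 hx2
  refine ⟨S x, W x, .of_analyticOnNhd hab.le (fun t ht => (hx t ht).2) (fun t ht => ?_)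
    (fun t ht => ?_) (fun t ht => ?_), ?_, ?_⟩
  · have aX := (aRX t ht).add (aPX x 1 t)
    have aY := (aRY t ht).add (aPY x 1 t)
    exact ((aq t ht 2).headingNear aX aY (hx t ht).1).flatControl aX aY
      ((aRX₁ t ht).add (aPX x 2 t))
      ((aRY₁ t ht).add (aPY x 2 t))
      ((aRX₂ t ht).add (aPX x 3 t))
      ((aRY₂ t ht).add (aPY x 3 t)) (sq_add_sq_ne_zero (hx t ht).1)
  · have aX := (aRX t ht).add (aPX x 1 t)
    have aY := (aRY t ht).add (aPY x 1 t)
    exact ((aq t ht 0).add (aPX x 0 t)).flatState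
      ((aq t ht 1).add (aPY x 0 t))
      ((aq t ht 2).headingNear aX aY (hx t ht).1) aX aY
      ((aRX₁ t ht).add (aPX x 2 t))
      ((aRY₁ t ht).add (aPY x 2 t)) (sq_add_sq_ne_zero (hx t ht).1)
  · exact hasDerivAt_flatState ((dq t ht 0).add (hasDerivAt_flatInterp_zero _ _ _ t))
      ((dq t ht 1).add (hasDerivAt_flatInterp_zero _ _ _ t)) (dq t ht 2)
      ((dRX t ht).add (hasDerivAt_flatInterp_one _ _ _ t))
      ((dRY t ht).add (hasDerivAt_flatInterp_one _ _ _ t))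
      ((dRX₁ t ht).add (hasDerivAt_flatInterp_two _ _ _ t))
      ((dRY₁ t ht).add (hasDerivAt_flatInterp_two _ _ _ t)) (hx t ht).1
  · have l : ∀ j : Fin 4, j ≠ 3 → PX j x a = 0 ∧ PY j x a = 0 := fun j hj =>
      ⟨flatInterp_left _ _ _ j hj, flatInterp_left _ _ _ j hj⟩
    simp only [hS, hΘ, l 0 (by decide), l 1 (by decide), l 2 (by decide), add_zero,
      hheading a haI]
    rw [flatState_polar (hv a haI)]
    ext i
    fin_cases i <;> rfl
  · obtain ⟨x0, x1, x2⟩ : PX 0 x b = _ ∧ PX 1 x b = _ ∧ PX 2 x b = _ :=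
      flatInterp_right _ _ _ hab.ne
    obtain ⟨y0, y1, y2⟩ : PY 0 x b = _ ∧ PY 1 x b = _ ∧ PY 2 x b = _ :=
      flatInterp_right _ _ _ hab.ne
    simp only [hS, hΘ, x0, x1, x2, y0, y1, y2, hRX, hRY, hRX₁, hRY₁, add_sub_cancel]
    rw [headingNear_polar hx3 hx2.1 hx2.2, flatState_polar hx3]
    ext i
    fin_cases i <;> rfl

end localOpenness

theorem exists_analytic_bump_orthogonal {a b : ℝ} (hab : a < b) {g h : ℝ → ℝ}
    (hg : Continuous g) (hh : Continuous h) :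
    ∃ φ φ₁ : ℝ → ℝ, (∀ t, AnalyticAt ℝ φ t) ∧ (∀ t, AnalyticAt ℝ φ₁ t) ∧
      (∀ t, HasDerivAt φ (φ₁ t) t) ∧ φ a = 0 ∧ φ b = 0 ∧ ∫ t in a..b, φ t * g t = 0 ∧
      ∫ t in a..b, φ t * h t = 0 ∧ ∃ t ∈ Ioo a b, φ t ≠ 0 := by
  set I : (ℝ → ℝ) → Fin 3 → ℝ := fun g i => ∫ t in a..b, (t - a) * (b - t) * t ^ (i : ℕ) * g t
    with hI
  set M : Matrix (Fin 2) (Fin 3) ℝ := Matrix.of ![I g, I h] with hM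
  obtain ⟨c, hc, hc0⟩ := (Submodule.ne_bot_iff _).1
    (LinearMap.ker_ne_bot_of_finrank_lt (f := M.mulVecLin) (by simp))
  have hint : ∀ g : ℝ → ℝ, Continuous g →
      ∫ t in a..b, (t - a) * (b - t) * (c 0 + c 1 * t + c 2 * t ^ 2) * g t =
        I g 0 * c 0 + I g 1 * c 1 + I g 2 * c 2 := by
    intro g hg
    have hi : ∀ i : Fin 3, IntervalIntegrable
        (fun t => (t - a) * (b - t) * t ^ (i : ℕ) * g t * c i) volume a b := fun i =>
      Continuous.intervalIntegrable (by fun_prop) a b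
    simp only [hI, ← intervalIntegral.integral_mul_const]
    rw [← intervalIntegral.integral_add (hi 0) (hi 1),
      ← intervalIntegral.integral_add ((hi 0).add (hi 1)) (hi 2)]
    refine intervalIntegral.integral_congr fun t _ => ?_
    simp
    ring
  have hker : ∀ i, (M.mulVec c) i = 0 := fun i => congrFun (LinearMap.mem_ker.1 hc) i
  refine ⟨fun t => (t - a) * (b - t) * (c 0 + c 1 * t + c 2 * t ^ 2),
    fun t => (b - t - (t - a)) * (c 0 + c 1 * t + c 2 * t ^ 2) +
      (t - a) * (b - t) * (c 1 + 2 * c 2 * t), by fun_prop, by fun_prop, fun t => ?_, by simp,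
    by simp, ?_, ?_, ?_⟩
  · have hid := hasDerivAt_id t
    refine (((hid.sub_const a).mul (hid.const_sub b)).mul
      (((hid.const_mul (c 1)).const_add (c 0)).add ((hid.pow 2).const_mul (c 2)))).congr_deriv ?_
    simp
    ring
  · rw [hint g hg]
    simpa [hM, Matrix.mulVec, dotProduct, Fin.sum_univ_three] using hker 0
  · rw [hint h hh]
    simpa [hM, Matrix.mulVec, dotProduct, Fin.sum_univ_three] using hker 1
  · by_contra! hzero
    refine hc0 ?_
    have hp : ∀ t ∈ Ioo a b, c 0 + c 1 * t + c 2 * t ^ 2 = 0 := fun t ht =>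
      (mul_eq_zero.1 (hzero t ht)).resolve_left
        (mul_ne_zero (sub_pos.2 ht.1).ne' (sub_pos.2 ht.2).ne')
    have hb : ∀ s ∈ Icc (1 : ℝ) 3, a + s * ((b - a) / 4) ∈ Ioo a b := fun s hs => by
      constructor <;> nlinarith [hs.1, hs.2]
    have h1 := hp _ (hb 1 (by norm_num))
    have h2 := hp _ (hb 2 (by norm_num))
    have h3 := hp _ (hb 3 (by norm_num))
    have hd : (b - a) / 4 ≠ 0 := by linarith
    set d := (b - a) / 4
    have e2 : c 2 = 0 := by
      refine (mul_eq_zero.1 (show 2 * d ^ 2 * c 2 = 0 by linear_combination h1 - 2 * h2 + h3))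
        |>.resolve_left (by positivity)
    rw [e2] at h1 h2
    have e1 : c 1 = 0 := by
      refine (mul_eq_zero.1 (show d * c 1 = 0 by linear_combination h2 - h1)) |>.resolve_left hd
    rw [e1] at h1
    have e0 : c 0 = 0 := by linarith
    ext i
    fin_cases i
    · exact e0
    · exact e1
    · exact e2

/-- A solution with continuous controls which stands still can be replaced by one with the same end
points which moves. -/
theorem IsControlSolution.exists_speed_ne_zero {A : ℝ} {K : Set (Fin 2 → ℝ)} {a b : ℝ}
    {q : ℝ → (Fin 5 → ℝ)} {w : ℝ → (Fin 2 → ℝ)} (hK : IsOpen K) (hab : a < b)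
    (h : IsControlSolution (chaplyginSleigh A) K a b q w) (hw : ContinuousOn w (Icc a b))
    (hv : ∀ t ∈ Icc a b, q t 3 = 0) :
    ∃ q' w', IsControlSolution (chaplyginSleigh A) K a b q' w' ∧ q' a = q a ∧ q' b = q b ∧
      ∃ t ∈ Ioo a b, q' t 3 ≠ 0 := by
  set Q : ℝ → Fin 5 → ℝ := IccExtend hab.le ((Icc a b).domRestrict q) with hQdef
  set W : ℝ → Fin 2 → ℝ := IccExtend hab.le ((Icc a b).domRestrict w) with hWdef
  have cQ : Continuous Q :=
    (continuousOn_iff_continuous_domRestrict.1 (h.continuousOn hab.le)).Icc_extend'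
  have cW : Continuous W := (continuousOn_iff_continuous_domRestrict.1 hw).Icc_extend'
  have hQq : EqOn Q q (Icc a b) := fun t ht => by rw [hQdef, IccExtend_of_mem hab.le _ ht]; rfl
  have hWw : EqOn W w (Icc a b) := fun t ht => by rw [hWdef, IccExtend_of_mem hab.le _ ht]; rfl
  have aQ : IsPiecewiseAnalyticOn Q a b := h.state_analytic.congr (hQq.mono Ioo_subset_Icc_self)
  have aW : IsPiecewiseAnalyticOn W a b := h.control_analytic.congr (hWw.mono Ioo_subset_Icc_self)
  have aQi : ∀ i, IsPiecewiseAnalyticOn (fun t => Q t i) a b := fun i =>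
    aQ.comp_left (φ := fun x : Fin 5 → ℝ => x i) fun x =>
      (ContinuousLinearMap.proj (R := ℝ) (φ := fun _ : Fin 5 => ℝ) i).analyticAt x
  have aWi : ∀ i, IsPiecewiseAnalyticOn (fun t => W t i) a b := fun i =>
    aW.comp_left (φ := fun x : Fin 2 → ℝ => x i) fun x =>
      (ContinuousLinearMap.proj (R := ℝ) (φ := fun _ : Fin 2 => ℝ) i).analyticAt x
  have han : ∀ g : ℝ → ℝ, (∀ t, AnalyticAt ℝ g t) → IsPiecewiseAnalyticOn g a b := fun g hg =>
    AnalyticOnNhd.isPiecewiseAnalyticOn hab.le fun t _ => hg t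
  have cc : Continuous fun t => Real.cos (Q t 2) := by fun_prop
  have cs : Continuous fun t => Real.sin (Q t 2) := by fun_prop
  obtain ⟨φ, φ₁, aφ, aφ₁, dφ, φa, φb, φc, φs, t₀, ht₀, hφ⟩ :=
    exists_analytic_bump_orthogonal hab cc cs
  have cφ : Continuous φ := continuous_iff_continuousAt.2 fun t => (aφ t).continuousAt
  have cφ₁ : Continuous φ₁ := continuous_iff_continuousAt.2 fun t => (aφ₁ t).continuousAt
  set w' : ℝ → ℝ → Fin 2 → ℝ := fun ε t => ![W t 0 + ε * (φ₁ t - A * φ t * Q t 4), W t 1]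
    with hw'
  have hev : ∀ᶠ ε in 𝓝 (0 : ℝ), ∀ t ∈ Icc a b, w' ε t ∈ K := by
    refine isCompact_Icc.eventually_forall_of_forall_eventually fun t ht => ?_
    have hc : Continuous fun z : ℝ × ℝ => w' z.1 z.2 := by
      refine continuous_pi fun i => ?_
      fin_cases i <;> simp [hw'] <;> fun_prop
    refine hc.continuousAt.eventually_mem (hK.mem_nhds ?_)
    have : w' 0 t = w t := by
      rw [← hWw ht]
      ext i
      fin_cases i <;> simp [hw']
    rw [this]
    exact h.control_mem t ht
  obtain ⟨ε, hε, hε0⟩ := ((hev.filter_mono nhdsWithin_le_nhds).and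
    (self_mem_nhdsWithin : Ioi (0 : ℝ) ∈ 𝓝[>] 0)).exists
  set q' : ℝ → Fin 5 → ℝ := fun t => ![Q t 0 + ε * ∫ s in a..t, φ s * Real.cos (Q s 2),
    Q t 1 + ε * ∫ s in a..t, φ s * Real.sin (Q s 2), Q t 2, Q t 3 + ε * φ t, Q t 4] with hq'
  have cIc : Continuous fun t => ∫ s in a..t, φ s * Real.cos (Q s 2) :=
    intervalIntegral.continuous_primitive
      (fun x y => (cφ.mul cc).intervalIntegrable x y) a
  have cIs : Continuous fun t => ∫ s in a..t, φ s * Real.sin (Q s 2) :=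
    intervalIntegral.continuous_primitive
      (fun x y => (cφ.mul cs).intervalIntegrable x y) a
  have haI : a ∈ Icc a b := left_mem_Icc.2 hab.le
  have hbI : b ∈ Icc a b := right_mem_Icc.2 hab.le
  refine ⟨q', w' ε, .of_continuousOn hab.le hε (.pi hab.le fun i => ?_) (.pi hab.le fun i => ?_)
    (Continuous.continuousOn (continuous_pi fun i => ?_)) ?_, ?_, ?_, t₀, ht₀, ?_⟩
  · fin_cases i
    · exact (aWi 0).add ((han (fun _ => ε) fun _ => analyticAt_const).mul ((han φ₁ aφ₁).sub
        (((han (fun _ => A) fun _ => analyticAt_const).mul (han φ aφ)).mul (aQi 4))))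
    · exact aWi 1
  · fin_cases i
    · exact (aQi 0).add ((han (fun _ => ε) fun _ => analyticAt_const).mul
        (IsPiecewiseAnalyticOn.intervalIntegral (cφ.mul cc) ((han φ aφ).mul
          ((aQi 2).comp_left (φ := Real.cos) fun _ => Real.analyticAt_cos)) a))
    · exact (aQi 1).add ((han (fun _ => ε) fun _ => analyticAt_const).mul
        (IsPiecewiseAnalyticOn.intervalIntegral (cφ.mul cs) ((han φ aφ).mul
          ((aQi 2).comp_left (φ := Real.sin) fun _ => Real.analyticAt_sin)) a))
    · exact aQi 2
    · exact (aQi 3).add ((han (fun _ => ε) fun _ => analyticAt_const).mul (han φ aφ))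
    · exact aQi 4
  · fin_cases i <;> simp [hq'] <;> fun_prop
  · have ha : ∀ᵐ t : ℝ, t ≠ a := by simp [ae_iff]
    have hb : ∀ᵐ t : ℝ, t ≠ b := by simp [ae_iff]
    filter_upwards [h.equation, ha, hb] with t ht ha hb htI
    have hnhds : Icc a b ∈ 𝓝 t := Icc_mem_nhds (htI.1.lt_of_ne' ha) (htI.2.lt_of_ne hb)
    have hd : HasDerivAt Q (chaplyginSleigh A t (Q t) (W t)) t := by
      rw [hQq htI, hWw htI]
      exact (ht htI).congr_of_eventuallyEq (by filter_upwards [hnhds] with s hs using hQq hs)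
    have hdi := hasDerivAt_pi.1 hd
    refine hasDerivAt_pi.2 fun i => ?_
    fin_cases i
    · refine ((hdi 0).add
        (((cφ.mul cc).integral_hasStrictDerivAt a t).hasDerivAt.const_mul ε)).congr_deriv ?_
      simp [chaplyginSleigh, hq']
      ring
    · refine ((hdi 1).add
        (((cφ.mul cs).integral_hasStrictDerivAt a t).hasDerivAt.const_mul ε)).congr_deriv ?_
      simp [chaplyginSleigh, hq']
      ring
    · exact hdi 2
    · refine ((hdi 3).add ((dφ t).const_mul ε)).congr_deriv ?_
      simp [chaplyginSleigh, hq', hw']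
      ring
    · exact hdi 4
  · rw [← hQq haI]
    ext i
    fin_cases i <;> simp [hq', φa]
  · rw [← hQq hbI]
    ext i
    fin_cases i <;> simp [hq', φb, φc, φs]
  · have : q' t₀ 3 = ε * φ t₀ := by
      simp [hq', hQq (Ioo_subset_Icc_self ht₀), hv t₀ (Ioo_subset_Icc_self ht₀)]
    rw [this]
    exact mul_ne_zero (ne_of_gt hε0) hφ

section hyperAccessibility

variable {A : ℝ} {K : Set (Fin 2 → ℝ)} {T : ℝ} {q : ℝ → (Fin 5 → ℝ)} {w : ℝ → (Fin 2 → ℝ)}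

theorem IsControlSolution.mem_reachBetween {a b : ℝ}
    (h : IsControlSolution (chaplyginSleigh A) K a b q w) :
    q b ∈ reachBetween (chaplyginSleigh A) K a b (q a) :=
  ⟨q, w, h, rfl, rfl⟩

/-- The end of a solution along which the speed does not vanish identically is an interior point of
the reachable set. -/
theorem IsControlSolution.reachBetween_mem_nhds (hK : IsOpen K)
    (h : IsControlSolution (chaplyginSleigh A) K 0 T q w) {t₀ : ℝ} (ht₀ : t₀ ∈ Ioo 0 T)
    (hv : q t₀ 3 ≠ 0) : reachBetween (chaplyginSleigh A) K 0 T (q 0) ∈ 𝓝 (q T) := by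
  have hT : 0 < T := ht₀.1.trans ht₀.2
  have hc : ContinuousAt (fun t => q t 3) t₀ := (continuous_apply 3).continuousAt.comp'
    ((h.continuousOn hT.le).continuousAt (Icc_mem_nhds ht₀.1 ht₀.2))
  obtain ⟨ε, hε, hball⟩ := Metric.eventually_nhds_iff_ball.1 (hc.eventually_ne hv)
  obtain ⟨a, b, hta, hab, hbu, aq, aw, hd⟩ := h.exists_regular_Icc ht₀.1.le
    (show t₀ < min T (t₀ + ε) by simp only [lt_min_iff]; exact ⟨ht₀.2, by linarith⟩)
    (min_le_left _ _)
  have hbT : b < T := hbu.trans_le (min_le_left _ _)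
  have hbε : b < t₀ + ε := hbu.trans_le (min_le_right _ _)
  have ha : 0 < a := ht₀.1.trans hta
  have hlocal := eventually_mem_reachBetween_of_speed_ne_zero hK hab aq aw hd
    (fun t ht => h.control_mem t ⟨ha.le.trans ht.1, ht.2.trans hbT.le⟩)
    (fun t ht => hball t (by
      rw [Real.ball_eq_Ioo]; exact ⟨by linarith [ht.1], by linarith [ht.2]⟩))
  have hend := (h.mono (ha.trans hab).le hbT.le le_rfl).eventually_exists_end_eq hbT.le hlocal
  have hstart := (h.mono le_rfl ha.le (hab.trans hbT).le).mem_reachBetween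
  filter_upwards [hend] with x hx
  obtain ⟨y, hy, hxy⟩ := hx
  exact reachBetween_trans (ha.trans hab).le hbT (reachBetween_trans ha.le hab hstart hy) hxy

/-- A solution at rest can be replaced by a solution with the same end points which moves. -/
theorem IsControlSolution.exists_moving (hK : IsOpen K) (hT : 0 < T)
    (h : IsControlSolution (chaplyginSleigh A) K 0 T q w) (hv : ∀ t ∈ Ioo 0 T, q t 3 = 0) :
    ∃ q' w', IsControlSolution (chaplyginSleigh A) K 0 T q' w' ∧ q' 0 = q 0 ∧ q' T = q T ∧
      ∃ t ∈ Ioo 0 T, q' t 3 ≠ 0 := by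
  obtain ⟨a, b, ha, hab, hbT, -, aw, -⟩ := h.exists_regular_Icc le_rfl hT le_rfl
  obtain ⟨q', w', h', ea, eb, t, ht, hne⟩ := (h.mono ha.le hab.le hbT.le).exists_speed_ne_zero hK hab
    aw.continuousOn fun t ht => hv t ⟨ha.trans_le ht.1, ht.2.trans_lt hbT⟩
  have h₁ := (h.mono le_rfl ha.le (hab.trans hbT).le).concat h' ha.le hab.le ea.symm
  have h₂ := h₁.concat (h.mono (ha.trans hab).le hbT.le le_rfl) (ha.trans hab).le hbT.le
    (by simpa [not_le.2 hab] using eb)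
  refine ⟨_, _, h₂, ?_, ?_, t, ⟨ha.trans ht.1, ht.2.trans hbT⟩, ?_⟩
  · simp [ha.le, (ha.trans hab).le]
  · simp [not_le.2 hbT]
  · simpa [ht.2.le, not_le.2 ht.1] using hne

theorem isHyperAccessible_chaplyginSleigh (hK : IsOpen K) :
    IsHyperAccessible (chaplyginSleigh A) K := by
  refine fun q₀ T hT => isOpen_iff_mem_nhds.2 ?_
  rintro _ ⟨q, w, h, rfl, rfl⟩
  by_cases hv : ∃ t ∈ Ioo 0 T, q t 3 ≠ 0
  · obtain ⟨t, ht, hne⟩ := hv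
    exact h.reachBetween_mem_nhds hK ht hne
  · push Not at hv
    obtain ⟨q', w', h', e0, eT, t, ht, hne⟩ := h.exists_moving hK hT hv
    have := h'.reachBetween_mem_nhds hK ht hne
    rwa [e0, eT] at this

end hyperAccessibility

theorem mainTheorem1 (A : ℝ) (K : Set (Fin 2 → ℝ)) (hK : IsOpen K) (hKc : IsConnected K) :
    IsHyperAccessible (chaplyginSleigh A) K ∧
      ∀ q₀ : Fin 5 → ℝ, IsEquilibriumState (chaplyginSleigh A) K q₀ →
        IsSmallTimeLocallyControllableAt (chaplyginSleigh A) K q₀ := by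
  refine ⟨isHyperAccessible_chaplyginSleigh hK, ?_⟩
  rintro q₀ ⟨T, w, hT, h⟩
  refine ⟨T, hT, Filter.mem_of_superset
    ((isHyperAccessible_chaplyginSleigh hK q₀ T hT).mem_nhds ⟨_, w, h, rfl, rfl⟩) ?_⟩
  exact fun x hx => .inr (mem_biUnion (right_mem_Ioc.2 hT) hx)
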